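/- Let $n\ge 1$ ($n=1$: scalar displacement, $n=3$: displacement vector), $\rho>0$. For $\mathbb{C}^n$-valued fields $u$ on $\mathbb{R}^3$ (real fields are a special case) write $\nabla u=(\partial_j u_i)_{i\le n,\,j\le 3}$ and $\mathrm{D}=\partial_t$. *Kernel in time.* Let $g:\mathbb{R}\to\mathbb{R}$ be locally integrable on $[0,\infty)$ and causally positive definite, i.e. $\int_{\mathbb{R}}\int_0^\infty g(y)\varphi(x-y)\varphi(x)\,dy\,dx\ge 0$ for every real $\varphi\in C_c^\infty(\mathbb{R})$. Let $m$ be its spectral measure: the positive tempered Radon measure on $\mathbb{R}$ with $g(|t|)=\int_{\mathbb{R}}e^{ist}\,m(ds)$ in the sense of distributions on $\mathbb{R}$ (that is, $m=\pi^{-1}\,\mathrm{Re}\,\hat g$ for the causal kernel $g$; $m$ may have infinite mass). *Stiffness operator.* Let $\hat H(k)$ be a real matrix acting on $\mathbb{C}^{n\times 3}$, measurable in $k\in\mathbb{R}^3$, symmetric and positive definite for each $k\ne0$. Let $H\ast_x$ and $H_{-1}\ast_x$ denote the pseudo-differential operators in $L^2(\mathbb{R}^3)$ with symbols $\hat H(k)$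 and $\hat H(k)^{-1}$, with respect to $\hat f(k)=\int e^{-ik\cdot x}f(x)\,dx$. *Solutions.* Let $u\in C^1([0,\infty);L^2(\mathbb{R}^3)^n)$ be such that $\nabla \mathrm{D}u(t)$ (weak gradient) and $\psi(t):=H\ast_x\nabla \mathrm{D}u(t)$ belong to $L^2$ and depend continuously on $t\ge0$ in $L^2$, and such that $$\rho\,\mathrm{D}^2u=\operatorname{div}\sigma,\qquad \sigma(t)=\int_0^t g(t-\tau)\,\psi(\tau)\,d\tau ,$$ holds for $t>0$ weakly in space: for all Schwartz functions $\varphi$ and all $i$, $\rho\,\frac{d}{dt}\int \mathrm{D}u_i\,\varphi\,dx=-\sum_j\int\sigma_{ij}\,\partial_j\varphi\,dx$. Put $\mathbf{y}(t,x;s)=\int_0^t e^{is(t-\tau)}\psi(\tau,x)\,d\tau$ and define the stored energy $$U(t)=\frac12\int_{\mathbb{R}}\int_{\mathbb{R}^3}\mathbf{y}(t,x;s)^\dagger\,\bigl(H_{-1}\ast_x\mathbf{y}(t,\cdot\,;s)\bigr)(x)\,dx\,m(ds).$$ Then for all $t\ge 0$: $\mathbf{y}(t,\cdot\,;s)$ lies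 in the $L^2$-domain of $H_{-1}\ast_x$ for every $s$ and the integral over $s$ defining $U(t)$ converges absolutely; energy is conserved, $$\frac{d}{dt}\left[\int_{\mathbb{R}^3}\frac{\rho\,|\mathrm{D}u|^2}{2}\,dx+U\right]=0$$ (one-sided derivative at $t=0$); and $U(t)$ is real and $U(t)\ge0$. -/

import Mathlib

open MeasureTheory Set Filter Topology FourierTransform SchwartzMap LineDeriv
open scoped ContDiff

noncomputable section

namespace NonlocalVisco

/-- Physical space `ℝ³`; also the space of wave vectors. -/
abbrev Space : Type := EuclideanSpace ℝ (Fin 3)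

/-- Complex scalar fields in `L²(ℝ³)`. -/
abbrev L2 : Type := Lp ℂ 2 (volume : Measure Space)

/-- Index set of the components `∂_j u_i` of a gradient field when `u` has `n` components
(`n = 1`: scalar displacement, `n = 3`: displacement vector). -/
abbrev GradIdx (n : ℕ) : Type := Fin n × Fin 3

/-- `∂f/∂x_j` of a tempered distribution. -/
def pderiv (j : Fin 3) (f : 𝓢'(Space, ℂ)) : 𝓢'(Space, ℂ) :=
  ∂_{(EuclideanSpace.single j (1 : ℝ) : Space)} f

/-- A real function `g` on the half line is causally positive definite: it is locally integrable on
`[0, ∞)` and `∫ (∫_0^∞ g(y) φ(x - y) dy) φ(x) dx ≥ 0` for all real test functions `φ`. -/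
def IsCausallyPositiveDefinite (g : ℝ → ℝ) : Prop :=
  LocallyIntegrableOn g (Ici 0) ∧
    ∀ φ : ℝ → ℝ, ContDiff ℝ ∞ φ → HasCompactSupport φ →
      0 ≤ ∫ x, ∫ y in Ioi (0 : ℝ), g y * φ (x - y) * φ x

/-- `m` is the spectral measure of `g`: a tempered positive measure on `ℝ` with
`g(|t|) = ∫ e^{ist} m(ds)` in the sense of distributions on `ℝ`. For a causal kernel `g` this says
`m = π⁻¹ Re ĝ`. The identity is tested against compactly supported `φ` because `g` is only locally
integrable; `m` may have infinite mass, and then `g` is unbounded at `0`. -/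
def IsSpectralMeasure (g : ℝ → ℝ) (m : Measure ℝ) : Prop :=
  m.HasTemperateGrowth ∧
    ∀ φ : 𝓢(ℝ, ℂ), HasCompactSupport φ →
      ∫ t : ℝ, (g |t| : ℂ) * φ t = ∫ s, (∫ t : ℝ, Complex.exp (Complex.I * s * t) * φ t) ∂m

section Multiplier

variable {ι : Type} [Fintype ι]

/-- The Fourier side `Â(k) f̂(k)`, `k = 2πξ`, of the operator with matrix symbol `A`.
Mathlib's transform is `𝓕 f ξ = ∫ e^{-2πi x·ξ} f(x) dx = f̂(2πξ)`. -/
def symbolMul (A : Space → Matrix ι ι ℝ) (f : ι → L2) (a : ι) (ξ : Space) : ℂ :=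
  ∑ b, (A ((2 * Real.pi) • ξ) a b : ℂ) * (𝓕 (f b) : L2) ξ

/-- `f` is in the `L²` domain of the operator with matrix symbol `A`. -/
def InDomain (A : Space → Matrix ι ι ℝ) (f : ι → L2) : Prop :=
  ∀ a, MemLp (symbolMul A f a) 2 volume

open Classical in
/-- The pseudo-differential operator with matrix symbol `A`, that is, convolution `K ∗ₓ f` with the
kernel `K` whose Fourier transform is `A` (value `0` outside of the domain `InDomain A`). -/
def symbolOp (A : Space → Matrix ι ι ℝ) (f : ι → L2) : ι → L2 := fun a =>
  if h : MemLp (symbolMul A f a) 2 volume then 𝓕⁻ (h.toLp (symbolMul A f a)) else 0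

end Multiplier

variable {n : ℕ}

/-- The stress `σ = g ∗ₜ ψ`, for a field `ψ`. -/
def stress (g : ℝ → ℝ) (ψ : ℝ → GradIdx n → L2) (t : ℝ) (a : GradIdx n) : L2 :=
  ∫ τ in (0 : ℝ)..t, (g (t - τ) : ℂ) • ψ τ a

/-- The auxiliary field `y(t, · ; s) = ∫_0^t e^{is(t-τ)} ψ(τ) dτ`. -/
def auxField (ψ : ℝ → GradIdx n → L2) (t s : ℝ) (a : GradIdx n) : L2 :=
  ∫ τ in (0 : ℝ)..t, Complex.exp (Complex.I * s * (t - τ)) • ψ τ a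

/-- `∫ y(t,x;s)† (H₋₁ ∗ₓ y(t,·;s))(x) dx`, where `H₋₁` is the kernel with Fourier transform
`Ĥ(k)⁻¹`. -/
def storedDensity (H : Space → Matrix (GradIdx n) (GradIdx n) ℝ) (ψ : ℝ → GradIdx n → L2)
    (t s : ℝ) : ℂ :=
  ∫ x, ∑ a, (starRingEnd ℂ) (auxField ψ t s a x) *
    symbolOp (fun k => (H k)⁻¹) (auxField ψ t s) a x

/-- The stored energy `U(t) = ½ ∫ ∫ ∫ y(t,x;s)† H₋₁(x - x') y(t,x';s) dx' dx m(ds)`. -/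
def storedEnergy (m : Measure ℝ) (H : Space → Matrix (GradIdx n) (GradIdx n) ℝ)
    (ψ : ℝ → GradIdx n → L2) (t : ℝ) : ℂ :=
  (1 / 2) * ∫ s, storedDensity H ψ t s ∂m

/-- The kinetic energy `∫ ρ |v|² / 2 dx`. -/
def kineticEnergy (ρ : ℝ) (v : Fin n → L2) : ℝ :=
  ∫ x, ρ * (∑ i, ‖v i x‖ ^ 2) / 2

/-- `u` is a (strong in time, weak in space) solution on `[0, ∞)` of
`ρ D²u = div σ`, `σ = g ∗ₜ H ∗ₓ ∇Du`, with velocity `v = Du` and velocity gradient `G = ∇Du`: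
`u` is a continuously differentiable curve in `L²`, the fields `∇Du` and `ψ = H ∗ₓ ∇Du` are
continuous curves in `L²`, and the momentum equation holds for `t > 0` against test functions. -/
structure IsSolution (ρ : ℝ) (g : ℝ → ℝ) (H : Space → Matrix (GradIdx n) (GradIdx n) ℝ)
    (u v : ℝ → Fin n → L2) (G : ℝ → GradIdx n → L2) : Prop where
  velocity : ∀ t, 0 ≤ t → HasDerivWithinAt u (v t) (Ici 0) t
  continuousOn_velocity : ContinuousOn v (Ici 0)
  gradient : ∀ t, 0 ≤ t → ∀ i j, (G t (i, j) : 𝓢'(Space, ℂ)) = pderiv j (v t i : 𝓢'(Space, ℂ))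
  continuousOn_gradient : ContinuousOn G (Ici 0)
  domain : ∀ t, 0 ≤ t → InDomain H (G t)
  continuousOn_psi : ContinuousOn (fun t => symbolOp H (G t)) (Ici 0)
  momentum : ∀ t, 0 < t → ∀ (i : Fin n) (φ : 𝓢(Space, ℂ)),
    HasDerivAt (fun τ => (ρ : ℂ) * (v τ i : 𝓢'(Space, ℂ)) φ)
      (∑ j, pderiv j (stress g (fun τ => symbolOp H (G τ)) t (i, j) : 𝓢'(Space, ℂ)) φ) t

end NonlocalVisco

end

/-!
Since the symbol `Ĥ` is real symmetric, the kernel `K(a, τ) = ∫ ψ(a)† ∇Du(τ) dx` is Hermitian on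
`[0, t]²`, and `∫ y† H₋₁y dx = ∬ e^{is(a-τ)} K(a, τ) da dτ` is the Fourier transform of the
autocorrelation `c(r) = ∫ K(τ + r, τ) dτ`. Positivity of `Ĥ` makes this transform nonnegative, so
the spectral identity `∫ ĉ dm = ∫ g(|r|) c(r) dr`, known for test functions, extends to the merely
continuous `c`: mollify and apply Fatou's lemma. As `c(-r)` is the conjugate of `c(r)`, the right
side is twice the real part of its causal half, and `U(t) = Re ∫_0^t ∫ σ(τ)† ∇Du(τ) dx dτ` is the
work done by the stress. The momentum balance, paired with `Du`, shows that the kinetic energy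
decreases at exactly that rate.
-/

noncomputable section

namespace NonlocalVisco

section Measure

variable {X E : Type*} [MeasurableSpace X] {μ : Measure X} [NormedAddCommGroup E]

theorem integral_mem_of_isClosed {𝕜 : Type*} [RCLike 𝕜] [NormedSpace ℝ E] [NormedSpace 𝕜 E]
    [CompleteSpace E] {S : Submodule 𝕜 E} (hS : IsClosed (S : Set E)) {f : X → E}
    (hf : ∀ᵐ x ∂μ, f x ∈ S) : ∫ x, f x ∂μ ∈ S := by
  by_cases hfint : Integrable f μ
  · have := hS.completeSpace_coe
    have hcomm := S.mkQL.integral_comp_comm hfint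
    have hzero : ∫ x, S.mkQL (f x) ∂μ = 0 :=
      integral_eq_zero_of_ae (hf.mono fun x hx => by simpa using hx)
    simpa using hcomm.symm.trans hzero
  · simp [integral_undef hfint]

theorem exists_seq_tendsto_ae_of_finite {κ : Type*} [Finite κ] {f : ℕ → κ → X → E}
    {g : κ → X → E} (hfg : ∀ i, TendstoInMeasure μ (fun k => f k i) atTop (g i)) :
    ∃ ns : ℕ → ℕ, StrictMono ns ∧
      ∀ᵐ x ∂μ, ∀ i, Tendsto (fun k => f (ns k) i x) atTop (𝓝 (g i x)) := by
  classical
  have := Fintype.ofFinite κ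
  suffices h : ∀ s : Finset κ, ∃ ns : ℕ → ℕ, StrictMono ns ∧
      ∀ i ∈ s, ∀ᵐ x ∂μ, Tendsto (fun k => f (ns k) i x) atTop (𝓝 (g i x)) by
    obtain ⟨ns, hns, hlim⟩ := h Finset.univ
    exact ⟨ns, hns, ae_all_iff.2 fun i => hlim i (Finset.mem_univ i)⟩
  intro s
  induction s using Finset.induction_on with
  | empty => exact ⟨id, strictMono_id, by simp⟩
  | insert i s _ ih =>
    obtain ⟨ns, hns, hlim⟩ := ih
    obtain ⟨ms, hms, hlim'⟩ := ((hfg i).comp hns.tendsto_atTop).exists_seq_tendsto_ae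
    refine ⟨ns ∘ ms, hns.comp hms, fun j hj => ?_⟩
    rcases Finset.mem_insert.1 hj with rfl | hj
    · exact hlim'
    · exact (hlim j hj).mono fun x hx => hx.comp hms.tendsto_atTop

theorem integrable_and_tendsto_integral_of_norm_le_limit [NormedSpace ℝ E] {f : ℕ → X → E}
    {F : X → E} (hf : ∀ k, Integrable (f k) μ)
    (hle : ∀ k, ∀ᵐ x ∂μ, ‖f k x‖ ≤ ‖F x‖)
    (hlim : ∀ᵐ x ∂μ, Tendsto (fun k => f k x) atTop (𝓝 (F x)))
    (hbdd : BddAbove (range fun k => ∫ x, ‖f k x‖ ∂μ)) :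
    Integrable F μ ∧ Tendsto (fun k => ∫ x, f k x ∂μ) atTop (𝓝 (∫ x, F x ∂μ)) := by
  obtain ⟨C, hC⟩ := hbdd
  have hfatou : ∫⁻ x, ‖F x‖ₑ ∂μ ≤ ENNReal.ofReal C :=
    calc ∫⁻ x, ‖F x‖ₑ ∂μ = ∫⁻ x, liminf (fun k => ‖f k x‖ₑ) atTop ∂μ :=
          lintegral_congr_ae (hlim.mono fun x hx => hx.enorm.liminf_eq.symm)
      _ ≤ liminf (fun k => ∫⁻ x, ‖f k x‖ₑ ∂μ) atTop :=
          lintegral_liminf_le' fun k => (hf k).aestronglyMeasurable.enorm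
      _ ≤ ENNReal.ofReal C := liminf_le_of_frequently_le' (Frequently.of_forall fun k => by
          rw [← ofReal_integral_norm_eq_lintegral_enorm (hf k)]
          exact ENNReal.ofReal_le_ofReal (hC ⟨k, rfl⟩))
  have hF : Integrable F μ :=
    ⟨aestronglyMeasurable_of_tendsto_ae _ (fun k => (hf k).aestronglyMeasurable) hlim,
      hfatou.trans_lt ENNReal.ofReal_lt_top⟩
  exact ⟨hF, tendsto_integral_of_dominated_convergence _
    (fun k => (hf k).aestronglyMeasurable) hF.norm hle hlim⟩

open scoped ComplexOrder in
theorem integrable_and_integral_eq_of_tendsto_integral {f : ℕ → X → ℂ} {F : X → ℂ} {L : ℂ}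
    (hf : ∀ k, Integrable (f k) μ) (hnonneg : ∀ k x, 0 ≤ f k x)
    (hle : ∀ k, ∀ᵐ x ∂μ, ‖f k x‖ ≤ ‖F x‖)
    (hlim : ∀ᵐ x ∂μ, Tendsto (fun k => f k x) atTop (𝓝 (F x)))
    (hL : Tendsto (fun k => ∫ x, f k x ∂μ) atTop (𝓝 L)) :
    Integrable F μ ∧ ∫ x, F x ∂μ = L := by
  have hnorm (k : ℕ) : ∫ x, ‖f k x‖ ∂μ = (∫ x, f k x ∂μ).re :=
    calc ∫ x, ‖f k x‖ ∂μ = ∫ x, RCLike.re (f k x) ∂μ :=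
          integral_congr_ae (Eventually.of_forall fun x =>
            (Complex.re_eq_norm.2 (hnonneg k x)).symm)
      _ = (∫ x, f k x ∂μ).re := integral_re (hf k)
  have hbdd : BddAbove (range fun k => ∫ x, ‖f k x‖ ∂μ) := by
    simp only [hnorm]
    exact ((Complex.continuous_re.tendsto L).comp hL).bddAbove_range
  obtain ⟨hF, hFlim⟩ := integrable_and_tendsto_integral_of_norm_le_limit hf hle hlim hbdd
  exact ⟨hF, tendsto_nhds_unique hFlim hL⟩

end Measure

section Matrix

variable {ι : Type*} {A : Matrix ι ι ℝ}

theorem isHermitian_map_ofReal (hA : A.IsHermitian) : (A.map ((↑) : ℝ → ℂ)).IsHermitian :=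
  hA.map _ fun _ => (Complex.conj_ofReal _).symm

open scoped ComplexOrder MatrixOrder in
theorem posSemidef_map_ofReal [Finite ι] (hA : A.PosSemidef) :
    (A.map ((↑) : ℝ → ℂ)).PosSemidef := by
  classical
  have := Fintype.ofFinite ι
  obtain ⟨B, rfl⟩ := CStarAlgebra.nonneg_iff_eq_star_mul_self.1 hA.nonneg
  have hmap : (star B * B).map Complex.ofRealHom =
      (B.map Complex.ofRealHom).conjTranspose * B.map Complex.ofRealHom := by
    rw [Matrix.map_mul, Matrix.star_eq_conjTranspose, Matrix.conjTranspose_map]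
    exact fun r => (Complex.conj_ofReal r).symm
  exact hmap ▸ Matrix.posSemidef_conjTranspose_mul_self _

end Matrix

section Multiplier

variable {ι : Type}

/-- The vector `ξ ↦ 𝓕 f(ξ)` of Fourier transforms of the components of an `L²` field. -/
def fourierVec (f : ι → L2) (ξ : Space) : ι → ℂ := fun a => (𝓕 (f a) : L2) ξ

theorem fourierVec_zero : ∀ᵐ ξ, fourierVec (0 : ι → L2) ξ = 0 := by
  filter_upwards [Lp.coeFn_zero ℂ 2 (volume : Measure Space)] with ξ hξ
  funext a
  simp only [fourierVec, Pi.zero_apply, FourierTransform.fourier_zero, hξ]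

theorem fourierVec_add [Finite ι] (f h : ι → L2) :
    ∀ᵐ ξ, fourierVec (f + h) ξ = fourierVec f ξ + fourierVec h ξ := by
  filter_upwards [ae_all_iff.2 fun a => Lp.coeFn_add (𝓕 (f a) : L2) (𝓕 (h a))] with ξ hξ
  funext a
  simp only [fourierVec, Pi.add_apply, FourierTransform.fourier_add, hξ]

theorem fourierVec_smul [Finite ι] (c : ℂ) (f : ι → L2) :
    ∀ᵐ ξ, fourierVec (c • f) ξ = c • fourierVec f ξ := by
  filter_upwards [ae_all_iff.2 fun a => Lp.coeFn_smul c (𝓕 (f a) : L2)] with ξ hξ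
  funext a
  simp only [fourierVec, Pi.smul_apply, FourierTransform.fourier_smul, hξ]

theorem ae_symbol_of_forall_ne_zero {A : Space → Matrix ι ι ℝ} {P : Matrix ι ι ℝ → Prop}
    (hA : ∀ k, k ≠ 0 → P (A k)) : ∀ᵐ ξ, P (A ((2 * Real.pi) • ξ)) := by
  filter_upwards [Measure.ae_ne volume (0 : Space)] with ξ hξ
  exact hA _ (smul_ne_zero (by positivity) hξ)

variable [Fintype ι]

/-- The matrix `Â(k)` of the symbol at `k = 2πξ`, acting on complex vectors. -/
def complexSymbol (A : Space → Matrix ι ι ℝ) (ξ : Space) : Matrix ι ι ℂ :=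
  (A ((2 * Real.pi) • ξ)).map ((↑) : ℝ → ℂ)

theorem symbolMul_eq_mulVec (A : Space → Matrix ι ι ℝ) (f : ι → L2) (a : ι) (ξ : Space) :
    symbolMul A f a ξ = (complexSymbol A ξ).mulVec (fourierVec f ξ) a := rfl

/-- The graph of the operator with matrix symbol `A`, as a subspace of pairs of `L²` fields. -/
def symbolGraph (A : Space → Matrix ι ι ℝ) : Submodule ℂ ((ι → L2) × (ι → L2)) where
  carrier := {p | ∀ᵐ ξ, fourierVec p.2 ξ = (complexSymbol A ξ).mulVec (fourierVec p.1 ξ)}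
  zero_mem' := by
    filter_upwards [fourierVec_zero (ι := ι)] with ξ hξ
    simp only [Prod.fst_zero, Prod.snd_zero, hξ, Matrix.mulVec_zero]
  add_mem' := by
    intro p q hp hq
    filter_upwards [hp, hq, fourierVec_add p.1 q.1, fourierVec_add p.2 q.2] with ξ hp hq h₁ h₂
    simp only [Prod.fst_add, Prod.snd_add, h₁, h₂, hp, hq, Matrix.mulVec_add]
  smul_mem' := by
    intro c p hp
    filter_upwards [hp, fourierVec_smul c p.1, fourierVec_smul c p.2] with ξ hp h₁ h₂
    simp only [Prod.smul_fst, Prod.smul_snd, h₁, h₂, hp, Matrix.mulVec_smul]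

theorem mem_symbolGraph {A : Space → Matrix ι ι ℝ} {f h : ι → L2} :
    (f, h) ∈ symbolGraph A ↔
      ∀ᵐ ξ, fourierVec h ξ = (complexSymbol A ξ).mulVec (fourierVec f ξ) := Iff.rfl

theorem isClosed_symbolGraph (A : Space → Matrix ι ι ℝ) :
    IsClosed (symbolGraph A : Set ((ι → L2) × (ι → L2))) := by
  refine IsSeqClosed.isClosed fun p q hp hpq => ?_
  have hfourier (c : (ι → L2) × (ι → L2) → L2) (hc : Continuous c) :
      TendstoInMeasure volume (fun k => (𝓕 (c (p k)) : L2)) atTop (𝓕 (c q) : L2) :=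
    tendstoInMeasure_of_tendsto_Lp (((continuous_fourier.comp hc).tendsto q).comp hpq)
  obtain ⟨ns, -, hns⟩ := exists_seq_tendsto_ae_of_finite
    (f := fun k => Sum.elim (fun a => (𝓕 ((p k).1 a) : L2)) fun a => (𝓕 ((p k).2 a) : L2))
    (g := Sum.elim (fun a => (𝓕 (q.1 a) : L2)) fun a => (𝓕 (q.2 a) : L2)) (μ := volume)
    (Sum.rec (fun a => hfourier (fun r => r.1 a) (by fun_prop))
      fun a => hfourier (fun r => r.2 a) (by fun_prop))
  filter_upwards [hns, ae_all_iff.2 fun k => hp (ns k)] with ξ hlim hmem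
  have hfst : Tendsto (fun k => fourierVec (p (ns k)).1 ξ) atTop (𝓝 (fourierVec q.1 ξ)) :=
    tendsto_pi_nhds.2 fun a => hlim (Sum.inl a)
  have hsnd : Tendsto (fun k => fourierVec (p (ns k)).2 ξ) atTop (𝓝 (fourierVec q.2 ξ)) :=
    tendsto_pi_nhds.2 fun a => hlim (Sum.inr a)
  refine tendsto_nhds_unique hsnd ?_
  simp only [hmem]
  exact ((Continuous.matrix_mulVec continuous_const continuous_id).tendsto _).comp hfst

theorem mem_symbolGraph_symbolOp {A : Space → Matrix ι ι ℝ} {f : ι → L2} (hf : InDomain A f) :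
    (f, symbolOp A f) ∈ symbolGraph A := by
  filter_upwards [ae_all_iff.2 fun a => (hf a).coeFn_toLp] with ξ hξ
  funext a
  rw [← symbolMul_eq_mulVec, ← hξ a, fourierVec]
  simp only [symbolOp, dif_pos (hf a), fourier_fourierInv_eq]

theorem fourier_ae_eq_symbolMul {A : Space → Matrix ι ι ℝ} {f h : ι → L2}
    (hfh : (f, h) ∈ symbolGraph A) (a : ι) : (𝓕 (h a) : L2) =ᵐ[volume] symbolMul A f a :=
  (mem_symbolGraph.1 hfh).mono fun _ hξ => congrFun hξ a

theorem inDomain_of_mem_symbolGraph {A : Space → Matrix ι ι ℝ} {f h : ι → L2}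
    (hfh : (f, h) ∈ symbolGraph A) : InDomain A f := fun a =>
  (memLp_congr_ae (fourier_ae_eq_symbolMul hfh a)).1 (Lp.memLp _)

theorem symbolOp_eq_of_mem_symbolGraph {A : Space → Matrix ι ι ℝ} {f h : ι → L2}
    (hfh : (f, h) ∈ symbolGraph A) : symbolOp A f = h := by
  funext a
  have hdom := inDomain_of_mem_symbolGraph hfh a
  have hfourier : hdom.toLp (symbolMul A f a) = 𝓕 (h a) :=
    Lp.ext (hdom.coeFn_toLp.trans (fourier_ae_eq_symbolMul hfh a).symm)
  simp only [symbolOp, dif_pos hdom, hfourier, fourierInv_fourier_eq]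

theorem mem_symbolGraph_inv [DecidableEq ι] {A : Space → Matrix ι ι ℝ}
    (hA : ∀ k, k ≠ 0 → IsUnit (A k).det) {f h : ι → L2} (hfh : (f, h) ∈ symbolGraph A) :
    (h, f) ∈ symbolGraph fun k => (A k)⁻¹ := by
  filter_upwards [ae_symbol_of_forall_ne_zero (P := fun B => IsUnit B.det) hA,
    mem_symbolGraph.1 hfh] with ξ hdet hξ
  have hinv : complexSymbol (fun k => (A k)⁻¹) ξ * complexSymbol A ξ = 1 := by
    have hmap := congrArg (Matrix.map · Complex.ofRealHom) (Matrix.nonsing_inv_mul _ hdet)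
    rwa [Matrix.map_mul, Matrix.map_one _ (map_zero _) (map_one _)] at hmap
  rw [hξ, Matrix.mulVec_mulVec, hinv, Matrix.one_mulVec]

theorem sum_inner_eq_integral_dotProduct (f h : ι → L2) :
    ∑ a, inner ℂ (f a) (h a) = ∫ ξ, star (fourierVec f ξ) ⬝ᵥ fourierVec h ξ := by
  simp only [dotProduct, Pi.star_apply, fourierVec]
  rw [integral_finsetSum _ fun a _ => ?_]
  · refine Finset.sum_congr rfl fun a _ => ?_
    rw [← Lp.inner_fourier_eq, L2.inner_def]
    exact integral_congr_ae (Eventually.of_forall fun ξ => mul_comm _ _)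
  · refine (L2.integrable_inner (𝕜 := ℂ) (𝓕 (f a) : L2) (𝓕 (h a))).congr ?_
    exact Eventually.of_forall fun ξ => mul_comm _ _

theorem sum_inner_comm_of_mem_symbolGraph {A : Space → Matrix ι ι ℝ}
    (hA : ∀ k, k ≠ 0 → (A k).IsHermitian) {f h f' h' : ι → L2} (hfh : (f, h) ∈ symbolGraph A)
    (hfh' : (f', h') ∈ symbolGraph A) :
    ∑ a, inner ℂ (h a) (f' a) = ∑ a, inner ℂ (f a) (h' a) := by
  rw [sum_inner_eq_integral_dotProduct, sum_inner_eq_integral_dotProduct]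
  refine integral_congr_ae ?_
  filter_upwards [ae_symbol_of_forall_ne_zero hA, mem_symbolGraph.1 hfh, mem_symbolGraph.1 hfh']
    with ξ hA hξ hξ'
  have hherm : (complexSymbol A ξ).IsHermitian := isHermitian_map_ofReal hA
  rw [hξ, hξ', Matrix.star_mulVec, hherm.eq, Matrix.dotProduct_mulVec]

open scoped ComplexOrder

theorem sum_inner_nonneg_of_mem_symbolGraph {A : Space → Matrix ι ι ℝ}
    (hA : ∀ k, k ≠ 0 → (A k).PosSemidef) {f h : ι → L2} (hfh : (f, h) ∈ symbolGraph A) :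
    0 ≤ ∑ a, inner ℂ (h a) (f a) := by
  rw [sum_inner_comm_of_mem_symbolGraph (fun k hk => (hA k hk).isHermitian) hfh hfh,
    sum_inner_eq_integral_dotProduct]
  refine integral_nonneg_of_ae ?_
  filter_upwards [ae_symbol_of_forall_ne_zero hA, mem_symbolGraph.1 hfh] with ξ hA hξ
  rw [hξ]
  exact (posSemidef_map_ofReal hA).dotProduct_mulVec_nonneg _

theorem setIntegral_smul_mem_symbolGraph {A : Space → Matrix ι ι ℝ} {s : Set ℝ}
    (hs : MeasurableSet s) {f h : ℝ → ι → L2} (hfh : ∀ τ ∈ s, (f τ, h τ) ∈ symbolGraph A)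
    {c : ℝ → ℂ} (hf : ∀ a, IntegrableOn (fun τ => c τ • f τ a) s)
    (hh : ∀ a, IntegrableOn (fun τ => c τ • h τ a) s) :
    ((fun a => ∫ τ in s, c τ • f τ a), fun a => ∫ τ in s, c τ • h τ a) ∈ symbolGraph A := by
  have hmem := integral_mem_of_isClosed (μ := volume.restrict s) (isClosed_symbolGraph A)
    (f := fun τ => (c τ • f τ, c τ • h τ))
    (ae_restrict_of_forall_mem hs fun τ hτ => (symbolGraph A).smul_mem (c τ) (hfh τ hτ))
  have hf' : IntegrableOn (fun τ => c τ • f τ) s := Integrable.of_eval hf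
  have hh' : IntegrableOn (fun τ => c τ • h τ) s := Integrable.of_eval hh
  rw [integral_pair hf' hh'] at hmem
  convert hmem using 2 <;> funext a
  · exact (eval_integral hf _).symm
  · exact (eval_integral hh _).symm

end Multiplier

section ExpTransform

/-- The transform `∫ e^{ist} f(t) dt`, with the sign and normalisation of `IsSpectralMeasure`. -/
def expTransform (f : ℝ → ℂ) (s : ℝ) : ℂ := ∫ t : ℝ, Complex.exp (Complex.I * s * t) * f t

theorem expTransform_eq_fourier (f : ℝ → ℂ) (s : ℝ) :
    expTransform f s = 𝓕 f (-(2 * Real.pi)⁻¹ * s) := by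
  rw [Real.fourier_real_eq_integral_exp_smul]
  refine integral_congr_ae (Eventually.of_forall fun t => ?_)
  simp only [smul_eq_mul]
  congr 2
  have hpi : (Real.pi : ℂ) ≠ 0 := by exact_mod_cast Real.pi_ne_zero
  push_cast
  field_simp

theorem integrable_expTransform (m : Measure ℝ) [m.HasTemperateGrowth] (φ : 𝓢(ℝ, ℂ)) :
    Integrable (expTransform φ) m := by
  have hc : -(2 * Real.pi)⁻¹ ≠ 0 := by simp [Real.pi_ne_zero]
  let scale : ℝ ≃L[ℝ] ℝ := ContinuousLinearEquiv.smulLeft (Units.mk0 _ hc)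
  refine ((compCLMOfContinuousLinearEquiv ℂ scale (𝓕 φ)).integrable (μ := m)).congr
    (Eventually.of_forall fun s => ?_)
  rw [expTransform_eq_fourier, ← SchwartzMap.fourier_coe]
  rfl

end ExpTransform

section Mollifier

open ContinuousLinearMap Convolution

variable {f : ℝ → ℂ}

/-- The mollification of `f`: its convolution with the normalised bump of `θ`. -/
def mollify (θ : ContDiffBump (0 : ℝ)) (f : ℝ → ℂ) : ℝ → ℂ :=
  θ.normed volume ⋆[lsmul ℝ ℝ] f

/-- The Fourier multiplier of `mollify θ`; it is real because the bump is even. -/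
def mollifierSymbol (θ : ContDiffBump (0 : ℝ)) (s : ℝ) : ℝ :=
  (expTransform (fun x => (θ.normed volume x : ℂ)) s).re

section Bump

variable (θ : ContDiffBump (0 : ℝ))

theorem contDiff_mollify (hf : LocallyIntegrable f) : ContDiff ℝ ∞ (mollify θ f) :=
  θ.hasCompactSupport_normed.contDiff_convolution_left _ θ.contDiff_normed hf

theorem hasCompactSupport_mollify (hf : HasCompactSupport f) : HasCompactSupport (mollify θ f) :=
  θ.hasCompactSupport_normed.convolution _ hf

theorem norm_mollify_le {C : ℝ} (hC : ∀ x, ‖f x‖ ≤ C) (x : ℝ) : ‖mollify θ f x‖ ≤ C :=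
  calc ‖mollify θ f x‖ ≤ ∫ t, θ.normed volume t * C :=
        norm_integral_le_of_norm_le (θ.integrable_normed.mul_const C)
          (Eventually.of_forall fun t => by
            rw [lsmul_apply, norm_smul, Real.norm_of_nonneg (θ.nonneg_normed t)]
            exact mul_le_mul_of_nonneg_left (hC _) (θ.nonneg_normed t))
    _ = C := by rw [integral_mul_const, θ.integral_normed, one_mul]

theorem mollify_eq_zero_of_add_rOut_lt {R : ℝ} (hf : ∀ x, R < |x| → f x = 0) {x : ℝ}
    (hx : R + θ.rOut < |x|) : mollify θ f x = 0 := by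
  refine integral_eq_zero_of_ae (Eventually.of_forall fun t => ?_)
  by_cases ht : t ∈ Function.support (θ.normed volume)
  · rw [θ.support_normed_eq, mem_ball_zero_iff, Real.norm_eq_abs] at ht
    have := abs_sub_abs_le_abs_sub x t
    simp [hf (x - t) (by linarith)]
  · simp [Function.notMem_support.1 ht]

theorem ofReal_mollifierSymbol (s : ℝ) :
    (mollifierSymbol θ s : ℂ) = expTransform (fun x => (θ.normed volume x : ℂ)) s := by
  rw [mollifierSymbol, ← Complex.conj_eq_iff_re, expTransform, ← integral_conj,
    ← integral_neg_eq_self]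
  refine integral_congr_ae (Eventually.of_forall fun t => ?_)
  simp only [map_mul, ← Complex.exp_conj, Complex.conj_I, Complex.conj_ofReal, θ.normed_neg,
    Complex.ofReal_neg, map_neg, mul_neg, neg_mul, neg_neg]

theorem expTransform_mollify (hf : Integrable f) (s : ℝ) :
    expTransform (mollify θ f) s = mollifierSymbol θ s * expTransform f s := by
  rw [ofReal_mollifierSymbol]
  simp only [expTransform_eq_fourier]
  exact Real.fourier_mul_convolution_eq (f₁ := fun x => (θ.normed volume x : ℂ))
    θ.integrable_normed.ofReal hf _

theorem expTransform_mollify_mollify (hf : Continuous f) (hfs : HasCompactSupport f) (s : ℝ) :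
    expTransform (mollify θ (mollify θ f)) s =
      (mollifierSymbol θ s ^ 2 : ℝ) * expTransform f s := by
  have hmoll : Integrable (mollify θ f) :=
    (contDiff_mollify θ hf.locallyIntegrable).continuous.integrable_of_hasCompactSupport
      (hasCompactSupport_mollify θ hfs)
  rw [expTransform_mollify θ hmoll,
    expTransform_mollify θ (hf.integrable_of_hasCompactSupport hfs)]
  push_cast
  ring

theorem abs_mollifierSymbol_le_one (s : ℝ) : |mollifierSymbol θ s| ≤ 1 := by
  refine (Complex.abs_re_le_norm _).trans ?_
  rw [← θ.integral_normed (μ := volume)]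
  refine norm_integral_le_of_norm_le θ.integrable_normed (Eventually.of_forall fun t => ?_)
  have harg : Complex.I * s * t = ((s * t : ℝ) : ℂ) * Complex.I := by push_cast; ring
  rw [norm_mul, harg, Complex.norm_exp_ofReal_mul_I, one_mul, Complex.norm_real,
    Real.norm_of_nonneg (θ.nonneg_normed t)]

end Bump

variable {θ : ℕ → ContDiffBump (0 : ℝ)}

theorem tendsto_mollifierSymbol (hθ : Tendsto (fun k => (θ k).rOut) atTop (𝓝 0)) (s : ℝ) :
    Tendsto (fun k => mollifierSymbol (θ k) s) atTop (𝓝 1) := by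
  have hconv := ContDiffBump.convolution_tendsto_right_of_continuous (μ := volume) hθ
    (g := fun x : ℝ => Complex.exp (Complex.I * s * ((-x : ℝ) : ℂ))) (by fun_prop) 0
  simp only [neg_zero, Complex.ofReal_zero, mul_zero, Complex.exp_zero] at hconv
  have hexp (k : ℕ) : ((θ k).normed volume ⋆[lsmul ℝ ℝ]
      fun x : ℝ => Complex.exp (Complex.I * s * ((-x : ℝ) : ℂ))) 0 =
      expTransform (fun x => ((θ k).normed volume x : ℂ)) s :=
    integral_congr_ae (Eventually.of_forall fun t => by simp [mul_comm])
  simp only [hexp] at hconv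
  exact (Complex.continuous_re.tendsto 1).comp hconv

theorem tendsto_mollify_mollify (hθ : Tendsto (fun k => (θ k).rOut) atTop (𝓝 0))
    (hf : Continuous f) (x : ℝ) :
    Tendsto (fun k => mollify (θ k) (mollify (θ k) f) x) atTop (𝓝 (f x)) := by
  have hmoll : Tendsto (Function.uncurry fun k => mollify (θ k) f) (atTop ×ˢ 𝓝 x) (𝓝 (f x)) :=
    ContDiffBump.convolution_tendsto_right (μ := volume) (φ := fun p : ℕ × ℝ => θ p.1)
      (g := fun _ => f) (hθ.comp tendsto_fst)
      (Eventually.of_forall fun _ => hf.aestronglyMeasurable)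
      ((hf.tendsto x).comp tendsto_snd) tendsto_snd
  exact ContDiffBump.convolution_tendsto_right (μ := volume) hθ
    (Eventually.of_forall fun k =>
      (contDiff_mollify (θ k) hf.locallyIntegrable).continuous.aestronglyMeasurable)
    hmoll tendsto_const_nhds

theorem tendsto_integral_mul_mollify_mollify (hθ : Tendsto (fun k => (θ k).rOut) atTop (𝓝 0))
    (hθ₁ : ∀ k, (θ k).rOut ≤ 1) {h : ℝ → ℂ} (hh : LocallyIntegrable h) (hf : Continuous f)
    (hfs : HasCompactSupport f) :
    Tendsto (fun k => ∫ t, h t * mollify (θ k) (mollify (θ k) f) t) atTop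
      (𝓝 (∫ t, h t * f t)) := by
  obtain ⟨C, hC⟩ := hfs.exists_bound_of_continuous hf
  obtain ⟨R, hR⟩ := hfs.isCompact.isBounded.subset_closedBall 0
  have hfR (x : ℝ) (hx : R < |x|) : f x = 0 := by
    refine image_eq_zero_of_notMem_tsupport fun hmem => hx.not_ge ?_
    simpa using hR hmem
  refine tendsto_integral_of_dominated_convergence
    ((Icc (-(R + 1 + 1)) (R + 1 + 1)).indicator fun t => ‖h t‖ * C) (fun k => ?_) ?_
    (fun k => Eventually.of_forall fun t => ?_)
    (Eventually.of_forall fun t => (tendsto_mollify_mollify hθ hf t).const_mul _)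
  · have hmoll := (contDiff_mollify (θ k) hf.locallyIntegrable).continuous
    exact hh.aestronglyMeasurable.mul
      (contDiff_mollify (θ k) hmoll.locallyIntegrable).continuous.aestronglyMeasurable
  · rw [integrable_indicator_iff measurableSet_Icc]
    exact (hh.integrableOn_isCompact isCompact_Icc).norm.mul_const C
  · by_cases ht : t ∈ Icc (-(R + 1 + 1)) (R + 1 + 1)
    · rw [indicator_of_mem ht, norm_mul]
      exact mul_le_mul_of_nonneg_left (norm_mollify_le _ (norm_mollify_le _ hC) t) (norm_nonneg _)
    · have htR : R + 1 + 1 < |t| := not_le.1 fun hle => ht (abs_le.1 hle)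
      have hzero : mollify (θ k) (mollify (θ k) f) t = 0 :=
        mollify_eq_zero_of_add_rOut_lt _ (fun x hx => mollify_eq_zero_of_add_rOut_lt _ hfR
          ((add_le_add_right (hθ₁ k) R).trans_lt hx)) ((add_le_add_right (hθ₁ k) _).trans_lt htR)
      rw [indicator_of_notMem ht, hzero, mul_zero, norm_zero]

theorem exists_seq_contDiffBump_tendsto_rOut_zero : ∃ θ : ℕ → ContDiffBump (0 : ℝ),
    Tendsto (fun k => (θ k).rOut) atTop (𝓝 0) ∧ ∀ k, (θ k).rOut ≤ 1 := by
  refine ⟨fun k => ⟨1 / ((k : ℝ) + 1) / 2, 1 / ((k : ℝ) + 1), by positivity,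
    half_lt_self (by positivity)⟩, tendsto_one_div_add_atTop_nhds_zero_nat, fun k => ?_⟩
  exact div_le_one_of_le₀ (by simp) (by positivity)

end Mollifier

section SpectralMeasure

theorem locallyIntegrable_comp_abs {g : ℝ → ℝ} (hg : LocallyIntegrableOn g (Ici 0)) :
    LocallyIntegrable fun t => g |t| := by
  have hpos (R : ℝ) : IntegrableOn (fun t => g |t|) (Icc 0 R) :=
    (hg.integrableOn_compact_subset Icc_subset_Ici_self isCompact_Icc).congr_fun
      (fun t ht => by rw [abs_of_nonneg ht.1]) measurableSet_Icc
  have hneg (R : ℝ) : IntegrableOn (fun t => g |t|) (Icc (-R) 0) := by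
    simpa using (hpos R).comp_neg
  rw [locallyIntegrable_iff]
  intro k hk
  obtain ⟨R, hR⟩ := hk.isBounded.subset_closedBall 0
  refine ((hneg R).union (hpos R)).mono_set fun t ht => ?_
  have hbound := abs_le.1 (mem_closedBall_zero_iff.1 (hR ht))
  exact (le_total t 0).imp (fun h => ⟨hbound.1, h⟩) fun h => ⟨h, hbound.2⟩

theorem locallyIntegrable_ofReal_comp_abs {g : ℝ → ℝ} (hg : LocallyIntegrableOn g (Ici 0)) :
    LocallyIntegrable fun t => (g |t| : ℂ) :=
  (locallyIntegrable_comp_abs hg).mono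
    (Complex.continuous_ofReal.comp_aestronglyMeasurable
      (locallyIntegrable_comp_abs hg).aestronglyMeasurable)
    (Eventually.of_forall fun _ => (Complex.norm_real _).le)

variable {g : ℝ → ℝ} {m : Measure ℝ} {f : ℝ → ℂ}

theorem IsSpectralMeasure.integrable_and_integral_expTransform_of_contDiff
    (hm : IsSpectralMeasure g m) (hf : ContDiff ℝ ∞ f) (hfs : HasCompactSupport f) :
    Integrable (expTransform f) m ∧ ∫ s, expTransform f s ∂m = ∫ t : ℝ, (g |t| : ℂ) * f t :=
  have := hm.1
  ⟨integrable_expTransform m (hfs.toSchwartzMap hf), (hm.2 (hfs.toSchwartzMap hf) hfs).symm⟩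

open scoped ComplexOrder in
theorem IsSpectralMeasure.integrable_and_integral_expTransform_of_nonneg
    (hm : IsSpectralMeasure g m) (hg : LocallyIntegrableOn g (Ici 0)) (hf : Continuous f)
    (hfs : HasCompactSupport f) (hnonneg : ∀ s, 0 ≤ expTransform f s) :
    Integrable (expTransform f) m ∧ ∫ s, expTransform f s ∂m = ∫ t : ℝ, (g |t| : ℂ) * f t := by
  obtain ⟨θ, hθ, hθ₁⟩ := exists_seq_contDiffBump_tendsto_rOut_zero
  -- Mollifying twice multiplies the transform by a square, which keeps it nonnegative.
  let φ : ℕ → ℝ → ℂ := fun k => mollify (θ k) (mollify (θ k) f)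
  have htransform (k : ℕ) : expTransform (φ k) =
      fun s => ((mollifierSymbol (θ k) s ^ 2 : ℝ) : ℂ) * expTransform f s :=
    funext (expTransform_mollify_mollify (θ k) hf hfs)
  have hspectral (k : ℕ) : Integrable (expTransform (φ k)) m ∧
      ∫ s, expTransform (φ k) s ∂m = ∫ t : ℝ, (g |t| : ℂ) * φ k t :=
    hm.integrable_and_integral_expTransform_of_contDiff
      (contDiff_mollify _ (contDiff_mollify _ hf.locallyIntegrable).continuous.locallyIntegrable)
      (hasCompactSupport_mollify _ (hasCompactSupport_mollify _ hfs))
  refine integrable_and_integral_eq_of_tendsto_integral (fun k => (hspectral k).1)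
    (fun k s => ?_) (fun k => Eventually.of_forall fun s => ?_)
    (Eventually.of_forall fun s => ?_) ?_
  · rw [htransform]
    exact mul_nonneg (Complex.zero_le_real.2 (sq_nonneg _)) (hnonneg s)
  · rw [htransform, norm_mul, Complex.norm_real, Real.norm_of_nonneg (sq_nonneg _)]
    exact mul_le_of_le_one_left (norm_nonneg _)
      ((sq_le_one_iff_abs_le_one _).2 (abs_mollifierSymbol_le_one _ s))
  · simp only [htransform]
    simpa using ((Complex.continuous_ofReal.tendsto _).comp
      ((tendsto_mollifierSymbol hθ s).pow 2)).mul_const (expTransform f s)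
  · simp only [(hspectral _).2]
    exact tendsto_integral_mul_mollify_mollify hθ hθ₁ (locallyIntegrable_ofReal_comp_abs hg) hf hfs

end SpectralMeasure

section Correlation

/-- The kernel `K` cut off outside the square `(0, t]²`. -/
def squareKernel (K : ℝ → ℝ → ℂ) (t : ℝ) : ℝ × ℝ → ℂ :=
  (Ioc 0 t ×ˢ Ioc 0 t).indicator (Function.uncurry K)

/-- The autocorrelation of a kernel `K` on `(0, t]²`: its integral along the diagonal `a - τ = r`.
It turns a double integral of `h (a - τ) * K a τ` into a single integral against `h`. -/
def correlation (K : ℝ → ℝ → ℂ) (t r : ℝ) : ℂ := ∫ τ, squareKernel K t (τ + r, τ)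

variable {K : ℝ → ℝ → ℂ} {t : ℝ}

theorem squareKernel_of_mem {a τ : ℝ} (ha : a ∈ Ioc 0 t) (hτ : τ ∈ Ioc 0 t) :
    squareKernel K t (a, τ) = K a τ :=
  indicator_of_mem (mk_mem_prod ha hτ) _

theorem squareKernel_of_notMem_left {a τ : ℝ} (ha : a ∉ Ioc 0 t) : squareKernel K t (a, τ) = 0 :=
  indicator_of_notMem (fun h => ha h.1) _

theorem squareKernel_of_notMem_right {a τ : ℝ} (hτ : τ ∉ Ioc 0 t) : squareKernel K t (a, τ) = 0 :=
  indicator_of_notMem (fun h => hτ h.2) _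

theorem squareKernel_eq_zero {a τ : ℝ} (h : a - τ ∉ Icc (-t) t) : squareKernel K t (a, τ) = 0 := by
  refine indicator_of_notMem (fun hmem => h ?_) _
  obtain ⟨⟨ha₀ : 0 < a, hat : a ≤ t⟩, hτ₀ : 0 < τ, hτt : τ ≤ t⟩ := hmem
  constructor <;> linarith

theorem squareKernel_swap
    (hherm : ∀ a ∈ Ioc 0 t, ∀ τ ∈ Ioc 0 t, K τ a = (starRingEnd ℂ) (K a τ))
    (a τ : ℝ) :
    squareKernel K t (τ, a) = (starRingEnd ℂ) (squareKernel K t (a, τ)) := by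
  by_cases ha : a ∈ Ioc 0 t
  · by_cases hτ : τ ∈ Ioc 0 t
    · rw [squareKernel_of_mem hτ ha, squareKernel_of_mem ha hτ, hherm a ha τ hτ]
    · rw [squareKernel_of_notMem_left hτ, squareKernel_of_notMem_right hτ, map_zero]
  · rw [squareKernel_of_notMem_right ha, squareKernel_of_notMem_left ha, map_zero]

theorem correlation_eq_zero {r : ℝ} (h : r ∉ Icc (-t) t) : correlation K t r = 0 :=
  integral_eq_zero_of_ae (Eventually.of_forall fun τ =>
    squareKernel_eq_zero (by rwa [add_sub_cancel_left]))

theorem hasCompactSupport_correlation : HasCompactSupport (correlation K t) :=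
  HasCompactSupport.intro (isCompact_Icc (a := -t) (b := t)) fun _ h => correlation_eq_zero h

theorem correlation_neg
    (hherm : ∀ a ∈ Ioc 0 t, ∀ τ ∈ Ioc 0 t, K τ a = (starRingEnd ℂ) (K a τ))
    (r : ℝ) :
    correlation K t (-r) = (starRingEnd ℂ) (correlation K t r) := by
  rw [correlation, correlation, ← integral_conj, ← integral_add_right_eq_self _ r]
  simp only [add_neg_cancel_right, ← squareKernel_swap hherm]

theorem measurable_squareKernel (hK : ContinuousOn (Function.uncurry K) (Icc 0 t ×ˢ Icc 0 t)) :
    Measurable (squareKernel K t) := by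
  classical
  have hsub : Ioc (0 : ℝ) t ×ˢ Ioc 0 t ⊆ Icc 0 t ×ˢ Icc 0 t :=
    prod_mono Ioc_subset_Icc_self Ioc_subset_Icc_self
  rw [squareKernel, ← piecewise_eq_indicator]
  exact (hK.mono hsub).measurable_piecewise continuousOn_const
    (measurableSet_Ioc.prod measurableSet_Ioc)

theorem exists_norm_squareKernel_le
    (hK : ContinuousOn (Function.uncurry K) (Icc 0 t ×ˢ Icc 0 t)) :
    ∃ C, ∀ a τ, ‖squareKernel K t (a, τ)‖ ≤ (Ioc 0 t).indicator (fun _ => C) τ := by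
  obtain ⟨C, hC⟩ := (isCompact_Icc.prod isCompact_Icc).exists_bound_of_continuousOn hK
  refine ⟨max C 0, fun a τ => ?_⟩
  by_cases hτ : τ ∈ Ioc 0 t
  · rw [indicator_of_mem hτ]
    by_cases ha : a ∈ Ioc 0 t
    · rw [squareKernel_of_mem ha hτ]
      exact (hC (a, τ) ⟨Ioc_subset_Icc_self ha, Ioc_subset_Icc_self hτ⟩).trans (le_max_left _ _)
    · rw [squareKernel_of_notMem_left ha, norm_zero]
      exact le_max_right _ _
  · rw [squareKernel_of_notMem_right hτ, indicator_of_notMem hτ, norm_zero]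

theorem continuousAt_squareKernel_add (hK : ContinuousOn (Function.uncurry K) (Icc 0 t ×ˢ Icc 0 t))
    {r τ : ℝ} (h₀ : τ + r ≠ 0) (ht : τ + r ≠ t) :
    ContinuousAt (fun r => squareKernel K t (τ + r, τ)) r := by
  have hadd : ContinuousAt (fun r : ℝ => τ + r) r := by fun_prop
  have hzero (h : ∀ᶠ r' in 𝓝 r, τ + r' ∉ Ioc 0 t) :
      ContinuousAt (fun r => squareKernel K t (τ + r, τ)) r :=
    continuousAt_const.congr (h.mono fun r' hr' => (squareKernel_of_notMem_left hr').symm)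
  by_cases hτ : τ ∈ Ioc 0 t
  · rcases lt_or_gt_of_ne h₀ with hr₀ | hr₀
    · exact hzero ((hadd.eventually_lt_const hr₀).mono fun r' h h' => h.not_gt h'.1)
    rcases lt_or_gt_of_ne ht with hrt | hrt
    · have hmem : ∀ᶠ r' in 𝓝 r, τ + r' ∈ Ioc 0 t :=
        ((hadd.eventually_const_lt hr₀).and (hadd.eventually_lt_const hrt)).mono
          fun r' h => ⟨h.1, h.2.le⟩
      have hsquare : Tendsto (fun r' => (τ + r', τ)) (𝓝 r) (𝓝[Icc 0 t ×ˢ Icc 0 t] (τ + r, τ)) :=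
        tendsto_nhdsWithin_iff.2 ⟨hadd.prodMk continuousAt_const, hmem.mono fun r' h =>
          ⟨Ioc_subset_Icc_self h, Ioc_subset_Icc_self hτ⟩⟩
      have hKr : ContinuousAt (fun r' => K (τ + r') τ) r :=
        (hK (τ + r, τ) ⟨⟨hr₀.le, hrt.le⟩, Ioc_subset_Icc_self hτ⟩).tendsto.comp hsquare
      exact hKr.congr (hmem.mono fun r' h => (squareKernel_of_mem h hτ).symm)
    · exact hzero ((hadd.eventually_const_lt hrt).mono fun r' h h' => h.not_ge h'.2)
  · simpa only [squareKernel_of_notMem_right hτ] using continuousAt_const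

theorem continuous_correlation (hK : ContinuousOn (Function.uncurry K) (Icc 0 t ×ˢ Icc 0 t)) :
    Continuous (correlation K t) := by
  obtain ⟨C, hC⟩ := exists_norm_squareKernel_le hK
  refine continuous_iff_continuousAt.2 fun r => continuousAt_of_dominated
    (bound := (Ioc 0 t).indicator fun _ => C) (Eventually.of_forall fun r' =>
      ((measurable_squareKernel hK).comp (by fun_prop)).aestronglyMeasurable)
    (Eventually.of_forall fun r' => Eventually.of_forall fun τ => hC _ _)
    ((integrable_indicator_iff measurableSet_Ioc).2 (by simp)) ?_
  filter_upwards [Measure.ae_ne volume (-r), Measure.ae_ne volume (t - r)] with τ hτ₀ hτt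
  exact continuousAt_squareKernel_add hK (fun h => hτ₀ (by linarith)) fun h => hτt (by linarith)

theorem integrable_mul_squareKernel_add
    (hK : ContinuousOn (Function.uncurry K) (Icc 0 t ×ˢ Icc 0 t)) {h : ℝ → ℂ}
    (hh : LocallyIntegrable h) :
    Integrable (Function.uncurry fun r τ => h r * squareKernel K t (τ + r, τ)) := by
  obtain ⟨C, hC⟩ := exists_norm_squareKernel_le hK
  have hsupp : Integrable ((Icc (-t) t).indicator h) :=
    (integrable_indicator_iff measurableSet_Icc).2 (hh.integrableOn_isCompact isCompact_Icc)
  have hbound : Integrable ((Ioc 0 t).indicator fun _ => C) :=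
    (integrable_indicator_iff measurableSet_Ioc).2 (by simp)
  refine (hsupp.norm.mul_prod hbound).mono' (hh.aestronglyMeasurable.comp_fst.mul
    ((measurable_squareKernel hK).comp (by fun_prop)).aestronglyMeasurable)
    (Eventually.of_forall fun ⟨r, τ⟩ => ?_)
  by_cases hr : r ∈ Icc (-t) t
  · rw [indicator_of_mem hr, Function.uncurry_apply_pair, norm_mul]
    exact mul_le_mul_of_nonneg_left (hC _ _) (norm_nonneg _)
  · rw [indicator_of_notMem hr, Function.uncurry_apply_pair,
      squareKernel_eq_zero (by rwa [add_sub_cancel_left]), mul_zero, norm_zero, zero_mul]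

theorem integral_mul_correlation (hK : ContinuousOn (Function.uncurry K) (Icc 0 t ×ˢ Icc 0 t))
    {h : ℝ → ℂ} (hh : LocallyIntegrable h) :
    ∫ r, h r * correlation K t r = ∫ τ in Ioc 0 t, ∫ a in Ioc 0 t, h (a - τ) * K a τ := by
  have hsupp (τ : ℝ) : (fun a => h (a - τ) * squareKernel K t (a, τ)) =
      (Ioc 0 t).indicator fun a => h (a - τ) * squareKernel K t (a, τ) :=
    (indicator_eq_self.2 (Function.support_subset_iff'.2 fun a ha => by
      rw [squareKernel_of_notMem_left ha, mul_zero])).symm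
  calc ∫ r, h r * correlation K t r = ∫ r, ∫ τ, h r * squareKernel K t (τ + r, τ) := by
        simp only [correlation, integral_const_mul]
    _ = ∫ τ, ∫ r, h r * squareKernel K t (τ + r, τ) :=
        integral_integral_swap (integrable_mul_squareKernel_add hK hh)
    _ = ∫ τ, ∫ a, h (a - τ) * squareKernel K t (a, τ) :=
        integral_congr_ae (Eventually.of_forall fun τ => by
          simpa only [add_sub_cancel] using
            integral_sub_right_eq_self (fun r => h r * squareKernel K t (τ + r, τ)) τ |>.symm)
    _ = ∫ τ in Ioc 0 t, ∫ a, h (a - τ) * squareKernel K t (a, τ) :=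
        (setIntegral_eq_integral_of_forall_compl_eq_zero fun τ hτ => by
          simp only [squareKernel_of_notMem_right hτ, mul_zero, integral_zero]).symm
    _ = ∫ τ in Ioc 0 t, ∫ a in Ioc 0 t, h (a - τ) * K a τ :=
        setIntegral_congr_fun measurableSet_Ioc fun τ hτ => by
          rw [hsupp τ, integral_indicator measurableSet_Ioc]
          exact setIntegral_congr_fun measurableSet_Ioc fun a ha => by
            simp only [squareKernel_of_mem ha hτ]

theorem setIntegral_Iic_mul_correlation
    (hK : ContinuousOn (Function.uncurry K) (Icc 0 t ×ˢ Icc 0 t)) {h : ℝ → ℂ}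
    (hh : LocallyIntegrable h) :
    ∫ r in Iic 0, h r * correlation K t r =
      ∫ τ in Ioc 0 t, ∫ a in Ioc 0 τ, h (a - τ) * K a τ := by
  have htriangle {τ : ℝ} (hτ : τ ∈ Ioc 0 t) : Ioc 0 t ∩ Iic τ = Ioc 0 τ := by
    rw [Ioc_inter_Iic, min_eq_right hτ.2]
  calc ∫ r in Iic 0, h r * correlation K t r
      = ∫ r, (Iic 0).indicator h r * correlation K t r := by
        rw [← integral_indicator measurableSet_Iic]
        simp only [indicator_mul_left]
    _ = ∫ τ in Ioc 0 t, ∫ a in Ioc 0 t, (Iic 0).indicator h (a - τ) * K a τ :=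
        integral_mul_correlation hK (hh.indicator measurableSet_Iic)
    _ = ∫ τ in Ioc 0 t, ∫ a in Ioc 0 τ, h (a - τ) * K a τ :=
        setIntegral_congr_fun measurableSet_Ioc fun τ hτ => by
          rw [← htriangle hτ, ← setIntegral_indicator measurableSet_Iic]
          refine setIntegral_congr_fun measurableSet_Ioc fun a _ => ?_
          simp only [indicator, mem_Iic, sub_nonpos, ite_mul, zero_mul]

theorem integral_eq_two_mul_re_of_neg_eq_conj {F : ℝ → ℂ} (hF : Integrable F)
    (hsymm : ∀ r, F (-r) = (starRingEnd ℂ) (F r)) :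
    ∫ r, F r = (2 * (∫ r in Iic 0, F r).re : ℝ) := by
  have hpos : ∫ r in Ioi 0, F r = (starRingEnd ℂ) (∫ r in Iic 0, F r) := by
    rw [← integral_conj, ← neg_zero, ← integral_comp_neg_Iic]
    simp only [hsymm, neg_zero]
  rw [← intervalIntegral.integral_Iic_add_Ioi hF.integrableOn hF.integrableOn, hpos,
    Complex.add_conj]

open scoped ComplexOrder in
theorem IsSpectralMeasure.integrable_and_integral_energyForm {g : ℝ → ℝ} {m : Measure ℝ}
    (hm : IsSpectralMeasure g m) (hg : LocallyIntegrableOn g (Ici 0))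
    (hK : ContinuousOn (Function.uncurry K) (Icc 0 t ×ˢ Icc 0 t))
    (hherm : ∀ a ∈ Ioc 0 t, ∀ τ ∈ Ioc 0 t, K τ a = (starRingEnd ℂ) (K a τ))
    (hnonneg : ∀ s : ℝ, 0 ≤ ∫ τ in Ioc 0 t, ∫ a in Ioc 0 t,
      Complex.exp (Complex.I * s * (a - τ)) * K a τ) :
    Integrable (fun s : ℝ => ∫ τ in Ioc 0 t, ∫ a in Ioc 0 t,
        Complex.exp (Complex.I * s * (a - τ)) * K a τ) m ∧
      ∫ s, (∫ τ in Ioc 0 t, ∫ a in Ioc 0 t, Complex.exp (Complex.I * s * (a - τ)) * K a τ) ∂m =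
        (2 * (∫ τ in Ioc 0 t, ∫ a in Ioc 0 τ, (g (τ - a) : ℂ) * K a τ).re : ℝ) := by
  have hgloc := locallyIntegrable_ofReal_comp_abs hg
  have htransform (s : ℝ) : ∫ τ in Ioc 0 t, ∫ a in Ioc 0 t,
      Complex.exp (Complex.I * s * (a - τ)) * K a τ = expTransform (correlation K t) s := by
    have hexp : Continuous fun r : ℝ => Complex.exp (Complex.I * s * r) := by fun_prop
    simpa only [Complex.ofReal_sub, expTransform] using
      (integral_mul_correlation hK hexp.locallyIntegrable).symm
  have htriangle : ∫ r in Iic 0, (g |r| : ℂ) * correlation K t r =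
      ∫ τ in Ioc 0 t, ∫ a in Ioc 0 τ, (g (τ - a) : ℂ) * K a τ := by
    rw [setIntegral_Iic_mul_correlation hK hgloc]
    refine setIntegral_congr_fun measurableSet_Ioc fun τ _ =>
      setIntegral_congr_fun measurableSet_Ioc fun a ha => ?_
    simp only [abs_sub_comm a, abs_of_nonneg (sub_nonneg.2 ha.2)]
  simp only [htransform] at hnonneg ⊢
  have hcont := continuous_correlation hK
  obtain ⟨hfint, heq⟩ := hm.integrable_and_integral_expTransform_of_nonneg hg hcont
    hasCompactSupport_correlation hnonneg
  refine ⟨hfint, heq.trans ?_⟩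
  rw [integral_eq_two_mul_re_of_neg_eq_conj, htriangle]
  · simpa only [smul_eq_mul] using
      hgloc.integrable_smul_right_of_hasCompactSupport hcont hasCompactSupport_correlation
  · intro r
    rw [abs_neg, correlation_neg hherm, map_mul, Complex.conj_ofReal]

end Correlation

section Curves

variable {E : Type*} [NormedAddCommGroup E]

theorem hasDerivWithinAt_integral_Ici [NormedSpace ℝ E] [CompleteSpace E] {f : ℝ → E} {a : ℝ}
    (hf : ContinuousOn f (Ici a)) {c t : ℝ} (hc : c ∈ Ici a) (ht : t ∈ Ici a) :
    HasDerivWithinAt (fun b => ∫ x in c..b, f x) (f t) (Ici a) t := by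
  have hIcc : Icc a (t + 1) ∈ 𝓝[Ici a] t :=
    inter_mem_nhdsWithin _ (Iic_mem_nhds (lt_add_one t))
  have hmem : Fact (t ∈ Icc a (t + 1)) := ⟨ht, (lt_add_one t).le⟩
  have hf' : ContinuousOn f (Icc a (t + 1)) := hf.mono Icc_subset_Ici_self
  exact (intervalIntegral.integral_hasDerivWithinAt_right
    (hf.mono (ordConnected_Ici.uIcc_subset hc ht)).intervalIntegrable
    (hf'.stronglyMeasurableAtFilter_nhdsWithin measurableSet_Icc t)
    (hf' t hmem.out)).mono_of_mem_nhdsWithin hIcc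

section Convolution

variable {𝕜 : Type*} [NormedField 𝕜] [NormedSpace 𝕜 E] {k : ℝ → 𝕜} {f : ℝ → E}

theorem continuousAt_indicator_Ioc_causalConvolution (hf : ContinuousOn f (Ici 0)) {r t : ℝ}
    (hr : r ≠ t) :
    ContinuousAt (fun t => (Ioc 0 t).indicator (fun r => k r • f (t - r)) r) t := by
  by_cases hr₀ : 0 < r
  · rcases lt_or_gt_of_ne hr with hrt | hrt
    · have hsub : ContinuousAt (fun t' : ℝ => t' - r) t := by fun_prop
      have hft : ContinuousAt (fun t' => f (t' - r)) t :=
        ContinuousAt.comp (g := f) (hf.continuousAt (Ici_mem_nhds (sub_pos.2 hrt))) hsub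
      refine (hft.const_smul (k r)).congr ((lt_mem_nhds hrt).mono fun t' ht' => ?_)
      exact (indicator_of_mem (s := Ioc 0 t') ⟨hr₀, ht'.le⟩ fun r => k r • f (t' - r)).symm
    · refine (continuousAt_const (y := (0 : E))).congr ((gt_mem_nhds hrt).mono fun t' ht' => ?_)
      exact (indicator_of_notMem (s := Ioc 0 t') (fun h => ht'.not_ge h.2)
        fun r => k r • f (t' - r)).symm
  · refine (continuousAt_const (y := (0 : E))).congr (Eventually.of_forall fun t' => ?_)
    exact (indicator_of_notMem (s := Ioc 0 t') (fun h => hr₀ h.1)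
      fun r => k r • f (t' - r)).symm

variable [NormedSpace ℝ E]

theorem intervalIntegral_causalConvolution_eq {t : ℝ} (ht : 0 ≤ t) :
    ∫ τ in (0 : ℝ)..t, k (t - τ) • f τ =
      ∫ r, (Ioc 0 t).indicator (fun r => k r • f (t - r)) r := by
  have hsub := intervalIntegral.integral_comp_sub_left (a := 0) (b := t)
    (fun r => k r • f (t - r)) t
  simp only [sub_sub_cancel, sub_self, sub_zero] at hsub
  rw [hsub, intervalIntegral.integral_of_le ht, integral_indicator measurableSet_Ioc]

theorem continuousOn_causalConvolution (hk : LocallyIntegrableOn k (Ici 0))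
    (hf : ContinuousOn f (Ici 0)) :
    ContinuousOn (fun t => ∫ τ in (0 : ℝ)..t, k (t - τ) • f τ) (Ici 0) := by
  intro t ht
  obtain ⟨C, hC⟩ := isCompact_Icc.exists_bound_of_continuousOn
    (hf.mono (Icc_subset_Ici_self : Icc 0 (t + 1) ⊆ Ici 0))
  have hk' (T : ℝ) : IntegrableOn k (Ioc 0 T) :=
    (hk.integrableOn_compact_subset Icc_subset_Ici_self isCompact_Icc).mono_set Ioc_subset_Icc_self
  have hmaps (t' : ℝ) : MapsTo (fun r => t' - r) (Ioc 0 t') (Icc 0 t') := fun r hr =>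
    ⟨sub_nonneg.2 hr.2, sub_le_self _ hr.1.le⟩
  suffices h : ContinuousWithinAt
      (fun t => ∫ r, (Ioc 0 t).indicator (fun r => k r • f (t - r)) r) (Ici 0) t from
    h.congr (fun t' ht' => intervalIntegral_causalConvolution_eq ht')
      (intervalIntegral_causalConvolution_eq ht)
  refine continuousWithinAt_of_dominated
    (bound := (Ioc 0 (t + 1)).indicator fun r => ‖k r‖ * C) (Eventually.of_forall fun t' => ?_) ?_
    ((integrable_indicator_iff measurableSet_Ioc).2 ((hk' _).norm.mul_const C))
    ((Measure.ae_ne volume t).mono fun r hr =>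
      (continuousAt_indicator_Ioc_causalConvolution hf hr).continuousWithinAt)
  · have hft : ContinuousOn (fun r => f (t' - r)) (Ioc 0 t') :=
      (hf.mono Icc_subset_Ici_self).comp (by fun_prop) (hmaps t')
    exact (aestronglyMeasurable_indicator_iff measurableSet_Ioc).2
      ((hk' t').aestronglyMeasurable.smul (hft.aestronglyMeasurable measurableSet_Ioc))
  · filter_upwards [mem_nhdsWithin_of_mem_nhds (gt_mem_nhds (lt_add_one t))] with t' ht'
    refine Eventually.of_forall fun r => ?_
    by_cases hr : r ∈ Ioc 0 t'
    · have hmem := hmaps t' hr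
      rw [indicator_of_mem hr, indicator_of_mem (Ioc_subset_Ioc_right ht'.le hr), norm_smul]
      exact mul_le_mul_of_nonneg_left (hC _ ⟨hmem.1, hmem.2.trans ht'.le⟩) (norm_nonneg _)
    · rw [indicator_of_notMem hr, norm_zero]
      exact indicator_nonneg (fun r' hr' => mul_nonneg (norm_nonneg _)
        ((norm_nonneg _).trans (hC 0 ⟨le_rfl, hr'.1.le.trans hr'.2⟩))) r

end Convolution

section Inner

variable {𝕜 F : Type*} [RCLike 𝕜] [NormedAddCommGroup F] [InnerProductSpace 𝕜 F] [NormedSpace ℝ F]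

theorem integral_inner_const [CompleteSpace F] {X : Type*} [MeasurableSpace X] {μ : Measure X}
    {f : X → F} (hf : Integrable f μ) (c : F) :
    ∫ x, inner 𝕜 (f x) c ∂μ = inner 𝕜 (∫ x, f x ∂μ) c := by
  rw [← inner_conj_symm, ← integral_inner hf, ← integral_conj]
  simp only [inner_conj_symm]

theorem inner_integral_integral [CompleteSpace F] {X Y : Type*} [MeasurableSpace X]
    [MeasurableSpace Y] {μ : Measure X} {ν : Measure Y} {f : X → F} {h : Y → F}
    (hf : Integrable f μ) (hh : Integrable h ν) :
    inner 𝕜 (∫ x, f x ∂μ) (∫ y, h y ∂ν) = ∫ y, ∫ x, inner 𝕜 (f x) (h y) ∂μ ∂ν := by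
  simp only [integral_inner_const hf, integral_inner hh]

theorem hasDerivWithinAt_inner_of_eq_zero {c S : ℝ → F} {S' : F} {s : Set ℝ} {t : ℝ}
    (hc : ContinuousWithinAt c s t) (hS : HasDerivWithinAt S S' s t) (hzero : S t = 0) :
    HasDerivWithinAt (fun b => inner 𝕜 (c b) (S b)) (inner 𝕜 (c t) S') s t := by
  rw [hasDerivWithinAt_iff_tendsto_slope] at hS ⊢
  refine ((hc.mono sdiff_subset).tendsto.inner hS).congr fun b => ?_
  simp only [slope_def_module, hzero, sub_zero, inner_zero_right, inner_smul_right_eq_smul]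

end Inner

end Curves

section Distribution

/-- Evaluation of an `L²` field at a Schwartz function, as a continuous functional of the field. -/
def evalSchwartz (φ : 𝓢(Space, ℂ)) : L2 →L[ℂ] ℂ :=
  (PointwiseConvergenceCLM.evalCLM (RingHom.id ℂ) ℂ φ).comp
    (Lp.toTemperedDistributionCLM ℂ (volume : Measure Space) 2)

theorem evalSchwartz_apply (φ : 𝓢(Space, ℂ)) (f : L2) :
    evalSchwartz φ f = (f : 𝓢'(Space, ℂ)) φ := rfl

theorem pderiv_apply (j : Fin 3) (f : L2) (φ : 𝓢(Space, ℂ)) :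
    pderiv j (f : 𝓢'(Space, ℂ)) φ =
      evalSchwartz (-∂_{(EuclideanSpace.single j (1 : ℝ) : Space)} φ) f := rfl

theorem fourier_pderiv_apply (j : Fin 3) (f : L2) (φ : 𝓢(Space, ℂ)) :
    (𝓕 (pderiv j (f : 𝓢'(Space, ℂ)))) φ =
      ∫ ξ, φ ξ * (2 * Real.pi * Complex.I * (ξ j : ℝ) * (𝓕 f : L2) ξ) := by
  have hgrowth : (fun ξ : Space =>
      ((inner ℝ ξ (EuclideanSpace.single j (1 : ℝ)) : ℝ) : ℂ)).HasTemperateGrowth := by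
    fun_prop
  rw [pderiv, TemperedDistribution.fourier_lineDerivOp_eq, Lp.fourier_toTemperedDistribution_eq]
  change (2 * Real.pi * Complex.I) * ((TemperedDistribution.smulLeftCLM ℂ
    (fun ξ : Space => ((inner ℝ ξ (EuclideanSpace.single j (1 : ℝ)) : ℝ) : ℂ)))
    (Lp.toTemperedDistribution (𝓕 f : L2))) φ = _
  rw [TemperedDistribution.smulLeftCLM_apply_apply, Lp.toTemperedDistribution_apply,
    ← integral_const_mul]
  refine integral_congr_ae (Eventually.of_forall fun ξ => ?_)
  beta_reduce
  rw [SchwartzMap.smulLeftCLM_apply_apply hgrowth]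
  simp only [EuclideanSpace.inner_single_right, smul_eq_mul, conj_trivial, one_mul]
  ring

theorem locallyIntegrable_mul_fourier (j : Fin 3) (f : L2) : LocallyIntegrable fun ξ : Space =>
    2 * Real.pi * Complex.I * (ξ j : ℝ) * (𝓕 f : L2) ξ := by
  have hf : LocallyIntegrable ((𝓕 f : L2) : Space → ℂ) :=
    (Lp.memLp (𝓕 f : L2)).locallyIntegrable one_le_two
  rw [← locallyIntegrableOn_univ] at hf ⊢
  exact hf.continuousOn_mul (by fun_prop) isOpen_univ.isLocallyClosed

theorem fourier_ae_eq_of_eq_sum_pderiv {κ : Type*} [Fintype κ] {f : L2} {j : κ → Fin 3}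
    {F : κ → L2}
    (h : ∀ φ, (f : 𝓢'(Space, ℂ)) φ = ∑ i, pderiv (j i) (F i : 𝓢'(Space, ℂ)) φ) :
    ∀ᵐ ξ, (𝓕 f : L2) ξ = ∑ i, 2 * Real.pi * Complex.I * (ξ (j i) : ℝ) * (𝓕 (F i) : L2) ξ := by
  refine ae_eq_of_integral_contDiff_smul_eq
    ((Lp.memLp (𝓕 f : L2)).locallyIntegrable one_le_two)
    (locallyIntegrable_finsetSum _ fun i _ => locallyIntegrable_mul_fourier (j i) (F i))
    fun g hg hgs => ?_
  have hgs' : HasCompactSupport fun ξ => (g ξ : ℂ) := hgs.comp_left Complex.ofReal_zero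
  let φ : 𝓢(Space, ℂ) := hgs'.toSchwartzMap (Complex.ofRealCLM.contDiff.comp hg)
  have hφ (ξ : Space) : φ ξ = (g ξ : ℂ) := rfl
  have hf : ∫ ξ, g ξ • (𝓕 f : L2) ξ = (f : 𝓢'(Space, ℂ)) (𝓕 φ) := by
    rw [← TemperedDistribution.fourier_apply, Lp.fourier_toTemperedDistribution_eq,
      Lp.toTemperedDistribution_apply]
    rfl
  simp only [hf, h, Finset.smul_sum]
  rw [integral_finsetSum _ fun i _ =>
    (locallyIntegrable_mul_fourier (j i) (F i)).integrable_smul_left_of_hasCompactSupport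
      hg.continuous hgs]
  refine Finset.sum_congr rfl fun i _ => ?_
  rw [← TemperedDistribution.fourier_apply, fourier_pderiv_apply]
  simp only [hφ, Complex.real_smul]

theorem inner_eq_neg_sum_inner_of_eq_sum_pderiv {w f : L2} {P F : Fin 3 → L2}
    (hP : ∀ j φ, (P j : 𝓢'(Space, ℂ)) φ = pderiv j (w : 𝓢'(Space, ℂ)) φ)
    (hf : ∀ φ, (f : 𝓢'(Space, ℂ)) φ = ∑ j, pderiv j (F j : 𝓢'(Space, ℂ)) φ) :
    inner ℂ w f = -∑ j, inner ℂ (P j) (F j) := by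
  have hPfourier (j : Fin 3) : ∀ᵐ ξ, (𝓕 (P j) : L2) ξ =
      2 * Real.pi * Complex.I * (ξ j : ℝ) * (𝓕 w : L2) ξ := by
    simpa only [Finset.univ_unique, Finset.sum_singleton] using
      fourier_ae_eq_of_eq_sum_pderiv (κ := Unit) (j := fun _ => j) (F := fun _ => w)
        (by simpa using hP j)
  rw [sum_inner_eq_integral_dotProduct, ← Lp.inner_fourier_eq, L2.inner_def, ← integral_neg]
  refine integral_congr_ae ?_
  filter_upwards [fourier_ae_eq_of_eq_sum_pderiv (j := id) hf, ae_all_iff.2 hPfourier]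
    with ξ hfξ hPξ
  simp only [hfξ, hPξ, dotProduct, fourierVec, Pi.star_apply, RCLike.star_def, RCLike.inner_apply,
    Finset.sum_mul, id, map_mul, Complex.conj_ofReal, Complex.conj_I, map_ofNat,
    ← Finset.sum_neg_distrib]
  exact Finset.sum_congr rfl fun j _ => by ring

end Distribution

section MomentumBalance

/-- The curve `w` in `L²` satisfies the scalar balance law `ρ ∂ₜw = div σ`, weakly in space, with
weak gradient `P = ∇w`. Each component of the velocity of an `IsSolution` is of this kind. -/
structure IsMomentumBalance (ρ : ℝ) (w : ℝ → L2) (P σ : ℝ → Fin 3 → L2) : Prop where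
  continuousOn : ContinuousOn w (Ici 0)
  gradient : ∀ t, 0 ≤ t → ∀ j, (P t j : 𝓢'(Space, ℂ)) = pderiv j (w t : 𝓢'(Space, ℂ))
  continuousOn_gradient : ∀ j, ContinuousOn (fun t => P t j) (Ici 0)
  continuousOn_flux : ∀ j, ContinuousOn (fun t => σ t j) (Ici 0)
  momentum : ∀ t, 0 < t → ∀ φ : 𝓢(Space, ℂ),
    HasDerivAt (fun τ => (ρ : ℂ) * (w τ : 𝓢'(Space, ℂ)) φ)
      (∑ j, pderiv j (σ t j : 𝓢'(Space, ℂ)) φ) t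

namespace IsMomentumBalance

variable {ρ : ℝ} {w : ℝ → L2} {P σ : ℝ → Fin 3 → L2}

theorem momentum_sub_eq (hw : IsMomentumBalance ρ w P σ) {a b : ℝ} (ha : 0 ≤ a) (hb : 0 ≤ b)
    (φ : 𝓢(Space, ℂ)) :
    (((ρ : ℂ) • (w b - w a) : L2) : 𝓢'(Space, ℂ)) φ =
      ∑ j, pderiv j ((∫ τ in a..b, σ τ j : L2) : 𝓢'(Space, ℂ)) φ := by
  have hsub : uIcc a b ⊆ Ici 0 := ordConnected_Ici.uIcc_subset ha hb
  have hσ (j : Fin 3) : IntervalIntegrable (fun τ => σ τ j) volume a b :=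
    ((hw.continuousOn_flux j).mono hsub).intervalIntegrable
  have hdiv (j : Fin 3) :
      IntervalIntegrable (fun τ => pderiv j (σ τ j : 𝓢'(Space, ℂ)) φ) volume a b :=
    ((evalSchwartz _).continuous.comp_continuousOn
      ((hw.continuousOn_flux j).mono hsub)).intervalIntegrable
  have hftc : ∫ τ in a..b, ∑ j, pderiv j (σ τ j : 𝓢'(Space, ℂ)) φ =
      (ρ : ℂ) * evalSchwartz φ (w b) - (ρ : ℂ) * evalSchwartz φ (w a) :=
    intervalIntegral.integral_eq_sub_of_hasDeriv_right
      (continuousOn_const.mul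
        ((evalSchwartz φ).continuous.comp_continuousOn (hw.continuousOn.mono hsub)))
      (fun t ht => (hw.momentum t ((le_min ha hb).trans_lt ht.1) φ).hasDerivWithinAt)
      (by simpa only [Finset.sum_fn] using IntervalIntegrable.sum Finset.univ fun j _ => hdiv j)
  calc (((ρ : ℂ) • (w b - w a) : L2) : 𝓢'(Space, ℂ)) φ
      = (ρ : ℂ) * evalSchwartz φ (w b) - (ρ : ℂ) * evalSchwartz φ (w a) := by
        rw [← evalSchwartz_apply, map_smul, map_sub, smul_eq_mul, mul_sub]
    _ = ∑ j, ∫ τ in a..b, pderiv j (σ τ j : 𝓢'(Space, ℂ)) φ := by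
        rw [← hftc, intervalIntegral.integral_finsetSum fun j _ => hdiv j]
    _ = ∑ j, pderiv j ((∫ τ in a..b, σ τ j : L2) : 𝓢'(Space, ℂ)) φ :=
        Finset.sum_congr rfl fun j _ =>
          ((evalSchwartz _).restrictScalars ℝ).intervalIntegral_comp_comm (hσ j)

theorem norm_sq_sub_eq (hw : IsMomentumBalance ρ w P σ) {a b : ℝ} (ha : 0 ≤ a) (hb : 0 ≤ b) :
    ρ * ‖w b‖ ^ 2 - ρ * ‖w a‖ ^ 2 =
      -∑ j, (inner ℂ (P b j + P a j) (∫ τ in a..b, σ τ j)).re := by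
  have hgradient (j : Fin 3) (φ : 𝓢(Space, ℂ)) :
      ((P b j + P a j : L2) : 𝓢'(Space, ℂ)) φ = pderiv j ((w b + w a : L2) : 𝓢'(Space, ℂ)) φ := by
    rw [pderiv_apply, map_add, ← pderiv_apply, ← pderiv_apply, ← hw.gradient b hb,
      ← hw.gradient a ha, ← evalSchwartz_apply, map_add]
    rfl
  have hinner : ((ρ : ℂ) * inner ℂ (w b + w a) (w b - w a)).re =
      (-∑ j, inner ℂ (P b j + P a j) (∫ τ in a..b, σ τ j)).re := by
    rw [← inner_smul_right,
      inner_eq_neg_sum_inner_of_eq_sum_pderiv hgradient (hw.momentum_sub_eq ha hb)]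
  have hsq (f : L2) : (inner ℂ f f).re = ‖f‖ ^ 2 := inner_self_eq_norm_sq (𝕜 := ℂ) f
  have hcross : (inner ℂ (w b) (w a)).re = (inner ℂ (w a) (w b)).re :=
    inner_re_symm (𝕜 := ℂ) _ _
  rw [Complex.neg_re, Complex.re_sum, Complex.re_ofReal_mul] at hinner
  rw [← hinner, inner_add_left, inner_sub_right, inner_sub_right]
  simp only [Complex.add_re, Complex.sub_re, hsq, hcross]
  ring

theorem hasDerivWithinAt_norm_sq (hw : IsMomentumBalance ρ w P σ) {t : ℝ} (ht : 0 ≤ t) :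
    HasDerivWithinAt (fun τ => ρ / 2 * ‖w τ‖ ^ 2) (-∑ j, (inner ℂ (σ t j) (P t j)).re)
      (Ici 0) t := by
  have hpair (j : Fin 3) : HasDerivWithinAt
      (fun b => (inner ℂ (P b j + P t j) (∫ τ in t..b, σ τ j)).re)
      (inner ℂ (P t j + P t j) (σ t j)).re (Ici 0) t :=
    Complex.reCLM.hasFDerivAt.comp_hasDerivWithinAt t (hasDerivWithinAt_inner_of_eq_zero
      ((hw.continuousOn_gradient j t ht).add continuousWithinAt_const)
      (hasDerivWithinAt_integral_Ici (hw.continuousOn_flux j) ht ht)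
      intervalIntegral.integral_same)
  have hvalue (j : Fin 3) :
      (inner ℂ (P t j + P t j) (σ t j)).re = 2 * (inner ℂ (σ t j) (P t j)).re := by
    have hsymm : (inner ℂ (P t j) (σ t j)).re = (inner ℂ (σ t j) (P t j)).re :=
      inner_re_symm (𝕜 := ℂ) _ _
    rw [inner_add_left, Complex.add_re, hsymm, two_mul]
  have hincrement (b : ℝ) (hb : b ∈ Ici 0) : ρ / 2 * ‖w b‖ ^ 2 = ρ / 2 * ‖w t‖ ^ 2 +
      -(1 / 2) * ∑ j, (inner ℂ (P b j + P t j) (∫ τ in t..b, σ τ j)).re := by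
    linear_combination (1 / 2) * hw.norm_sq_sub_eq ht hb
  have hderiv := ((HasDerivWithinAt.fun_sum (u := Finset.univ) fun j _ => hpair j).const_mul
    (-(1 / 2))).const_add (ρ / 2 * ‖w t‖ ^ 2)
  refine (hderiv.congr hincrement (hincrement t ht)).congr_deriv ?_
  simp only [hvalue, ← Finset.mul_sum]
  ring

end IsMomentumBalance

variable {n : ℕ}

theorem norm_sq_eq_integral (f : L2) : ‖f‖ ^ 2 = ∫ x, ‖f x‖ ^ 2 :=
  calc ‖f‖ ^ 2 = RCLike.re (inner ℂ f f) := (inner_self_eq_norm_sq (𝕜 := ℂ) f).symm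
    _ = ∫ x, RCLike.re (inner ℂ (f x) (f x)) := (integral_re (L2.integrable_inner f f)).symm
    _ = ∫ x, ‖f x‖ ^ 2 := by simp only [inner_self_eq_norm_sq]

theorem kineticEnergy_eq (ρ : ℝ) (v : Fin n → L2) :
    kineticEnergy ρ v = ∑ i, ρ / 2 * ‖v i‖ ^ 2 := by
  have hfint (i : Fin n) : Integrable fun x => ‖v i x‖ ^ 2 :=
    (memLp_two_iff_integrable_sq_norm (Lp.aestronglyMeasurable (v i))).1 (Lp.memLp (v i))
  simp only [kineticEnergy, mul_div_right_comm ρ]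
  simp only [Finset.mul_sum, norm_sq_eq_integral, ← integral_const_mul]
  exact integral_finsetSum _ fun i _ => (hfint i).const_mul _

theorem continuousOn_stress {g : ℝ → ℝ} (hg : LocallyIntegrableOn g (Ici 0))
    {ψ : ℝ → GradIdx n → L2} (hψ : ContinuousOn ψ (Ici 0)) (a : GradIdx n) :
    ContinuousOn (fun t => stress g ψ t a) (Ici 0) := by
  have hg' : LocallyIntegrableOn (fun t => (g t : ℂ)) (Ici 0) := fun t ht =>
    (hg t ht).imp fun _ h => ⟨h.1, h.2.ofReal⟩
  exact continuousOn_causalConvolution hg' (continuousOn_pi.1 hψ a)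

namespace IsSolution

variable {ρ : ℝ} {g : ℝ → ℝ} {H : Space → Matrix (GradIdx n) (GradIdx n) ℝ}
  {u v : ℝ → Fin n → L2} {G : ℝ → GradIdx n → L2}

theorem isMomentumBalance (hu : IsSolution ρ g H u v G) (hg : LocallyIntegrableOn g (Ici 0))
    (i : Fin n) : IsMomentumBalance ρ (fun t => v t i) (fun t j => G t (i, j))
      fun t j => stress g (fun τ => symbolOp H (G τ)) t (i, j) where
  continuousOn := continuousOn_pi.1 hu.continuousOn_velocity i
  gradient t ht := hu.gradient t ht i
  continuousOn_gradient j := continuousOn_pi.1 hu.continuousOn_gradient (i, j)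
  continuousOn_flux j := continuousOn_stress hg hu.continuousOn_psi (i, j)
  momentum t ht := hu.momentum t ht i

theorem hasDerivWithinAt_kineticEnergy (hu : IsSolution ρ g H u v G)
    (hg : LocallyIntegrableOn g (Ici 0)) {t : ℝ} (ht : 0 ≤ t) :
    HasDerivWithinAt (fun τ => kineticEnergy ρ (v τ))
      (-(∑ c, inner ℂ (stress g (fun τ => symbolOp H (G τ)) t c) (G t c)).re) (Ici 0) t := by
  simp only [kineticEnergy_eq]
  refine (HasDerivWithinAt.fun_sum fun i _ =>
    (hu.isMomentumBalance hg i).hasDerivWithinAt_norm_sq ht).congr_deriv ?_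
  rw [Fintype.sum_prod_type, Complex.re_sum, ← Finset.sum_neg_distrib]
  simp only [Complex.re_sum]

end IsSolution

end MomentumBalance

section Energy

variable {n : ℕ} {ψ G : ℝ → GradIdx n → L2} {t : ℝ}

/-- The pairing `∫ ψ(a)† G(τ) dx` of two curves of fields, as a kernel in the two times. -/
def energyKernel (ψ G : ℝ → GradIdx n → L2) (a τ : ℝ) : ℂ :=
  ∑ c, inner ℂ (ψ a c) (G τ c)

theorem continuousOn_energyKernel (hψ : ContinuousOn ψ (Ici 0)) (hG : ContinuousOn G (Ici 0)) :
    ContinuousOn (Function.uncurry (energyKernel ψ G)) (Icc 0 t ×ˢ Icc 0 t) :=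
  continuousOn_finsetSum _ fun c _ =>
    ((continuousOn_pi.1 hψ c).comp continuousOn_fst fun _ hp => hp.1.1).inner
      ((continuousOn_pi.1 hG c).comp continuousOn_snd fun _ hp => hp.2.1)

theorem auxField_eq_setIntegral (ht : 0 ≤ t) (s : ℝ) : auxField ψ t s =
    fun c => ∫ τ in Ioc 0 t, Complex.exp (Complex.I * s * (t - τ)) • ψ τ c :=
  funext fun _ => intervalIntegral.integral_of_le ht

theorem integrableOn_exp_smul (hψ : ContinuousOn ψ (Ici 0)) (s : ℝ) (c : GradIdx n) :
    IntegrableOn (fun τ : ℝ => Complex.exp (Complex.I * s * (t - τ)) • ψ τ c) (Ioc 0 t) := by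
  have hcont : ContinuousOn (fun τ : ℝ => Complex.exp (Complex.I * s * (t - τ)) • ψ τ c)
      (Icc 0 t) :=
    (by fun_prop : Continuous fun τ : ℝ => Complex.exp (Complex.I * s * (t - τ))).continuousOn.smul
      ((continuousOn_pi.1 hψ c).mono Icc_subset_Ici_self)
  exact (hcont.integrableOn_compact isCompact_Icc).mono_set Ioc_subset_Icc_self

theorem inner_exp_smul_exp_smul {E : Type*} [NormedAddCommGroup E] [InnerProductSpace ℂ E]
    (s t a τ : ℝ) (x y : E) :
    inner ℂ (Complex.exp (Complex.I * s * (t - a)) • x)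
        (Complex.exp (Complex.I * s * (t - τ)) • y) =
      Complex.exp (Complex.I * s * (a - τ)) * inner ℂ x y := by
  rw [inner_smul_left, inner_smul_right, ← mul_assoc, ← Complex.exp_conj, ← Complex.exp_add]
  congr 2
  simp only [map_mul, map_sub, Complex.conj_I, Complex.conj_ofReal]
  ring

theorem sum_inner_auxField (hψ : ContinuousOn ψ (Ici 0)) (hG : ContinuousOn G (Ici 0))
    (ht : 0 ≤ t) (s : ℝ) :
    ∑ c, inner ℂ (auxField ψ t s c) (auxField G t s c) =
      ∫ τ in Ioc 0 t, ∫ a in Ioc 0 t,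
        Complex.exp (Complex.I * s * (a - τ)) * energyKernel ψ G a τ := by
  have hψs (c : GradIdx n) := integrableOn_exp_smul (t := t) hψ s c
  have hGs (c : GradIdx n) := integrableOn_exp_smul (t := t) hG s c
  have hinner (c : GradIdx n) (τ : ℝ) : Integrable (fun a : ℝ =>
      inner ℂ (Complex.exp (Complex.I * s * (t - a)) • ψ a c)
        (Complex.exp (Complex.I * s * (t - τ)) • G τ c)) (volume.restrict (Ioc 0 t)) :=
    (hψs c).inner_const _
  have houter (c : GradIdx n) : Integrable (fun τ : ℝ => ∫ a in Ioc 0 t,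
      inner ℂ (Complex.exp (Complex.I * s * (t - a)) • ψ a c)
        (Complex.exp (Complex.I * s * (t - τ)) • G τ c)) (volume.restrict (Ioc 0 t)) := by
    simp only [integral_inner_const (hψs c)]
    exact (hGs c).const_inner _
  simp only [auxField_eq_setIntegral ht, inner_integral_integral (hψs _) (hGs _), energyKernel,
    Finset.mul_sum, ← inner_exp_smul_exp_smul s t]
  rw [← integral_finsetSum _ fun c _ => houter c]
  simp only [integral_finsetSum _ fun c _ => hinner c _]

theorem setIntegral_energyKernel {g : ℝ → ℝ} (hg : LocallyIntegrableOn g (Ici 0))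
    (hψ : ContinuousOn ψ (Ici 0)) (ht : 0 ≤ t) :
    ∫ a in Ioc 0 t, (g (t - a) : ℂ) * energyKernel ψ G a t =
      ∑ c, inner ℂ (stress g ψ t c) (G t c) := by
  have hgt : IntervalIntegrable (fun a => (g (t - a) : ℂ)) volume 0 t := by
    have hg₀ : IntervalIntegrable g volume (t - 0) (t - t) := by
      rw [sub_zero, sub_self, intervalIntegrable_iff, uIoc_of_ge ht]
      exact (hg.integrableOn_compact_subset Icc_subset_Ici_self isCompact_Icc).mono_set
        Ioc_subset_Icc_self
    have hsub := hg₀.comp_sub_left t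
    simp only [sub_zero, sub_self] at hsub
    exact ⟨hsub.1.ofReal, hsub.2.ofReal⟩
  have hsmul (c : GradIdx n) :
      Integrable (fun a => (g (t - a) : ℂ) • ψ a c) (volume.restrict (Ioc 0 t)) :=
    (intervalIntegrable_iff_integrableOn_Ioc_of_le ht).1 (hgt.smul_continuousOn
      ((continuousOn_pi.1 hψ c).mono (uIcc_of_le ht ▸ Icc_subset_Ici_self)))
  have hinner (c : GradIdx n) (a : ℝ) : (g (t - a) : ℂ) * inner ℂ (ψ a c) (G t c) =
      inner ℂ ((g (t - a) : ℂ) • ψ a c) (G t c) := by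
    rw [inner_smul_left, Complex.conj_ofReal]
  simp only [energyKernel, Finset.mul_sum, hinner, stress, intervalIntegral.integral_of_le ht]
  rw [integral_finsetSum _ fun c _ => (hsmul c).inner_const _]
  simp only [integral_inner_const (hsmul _)]

theorem auxField_mem_symbolGraph {A : Space → Matrix (GradIdx n) (GradIdx n) ℝ}
    (hG : ContinuousOn G (Ici 0)) (hψ : ContinuousOn ψ (Ici 0))
    (hgraph : ∀ τ, 0 ≤ τ → (G τ, ψ τ) ∈ symbolGraph A) (ht : 0 ≤ t) (s : ℝ) :
    (auxField G t s, auxField ψ t s) ∈ symbolGraph A := by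
  rw [auxField_eq_setIntegral ht, auxField_eq_setIntegral ht]
  exact setIntegral_smul_mem_symbolGraph measurableSet_Ioc (fun τ hτ => hgraph τ hτ.1.le)
    (integrableOn_exp_smul hG s) (integrableOn_exp_smul hψ s)

theorem storedDensity_eq_sum_inner {H : Space → Matrix (GradIdx n) (GradIdx n) ℝ} {s : ℝ}
    {f : GradIdx n → L2} (hf : (auxField ψ t s, f) ∈ symbolGraph fun k => (H k)⁻¹) :
    storedDensity H ψ t s = ∑ c, inner ℂ (auxField ψ t s c) (f c) := by
  simp only [storedDensity, symbolOp_eq_of_mem_symbolGraph hf, L2.inner_def]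
  rw [← integral_finsetSum _ fun c _ => L2.integrable_inner _ _]
  simp only [RCLike.inner_apply, mul_comm]

namespace IsSolution

open scoped ComplexOrder

variable {ρ : ℝ} {g : ℝ → ℝ} {H : Space → Matrix (GradIdx n) (GradIdx n) ℝ}
  {u v : ℝ → Fin n → L2} {m : Measure ℝ}

theorem mem_symbolGraph (hu : IsSolution ρ g H u v G) {τ : ℝ} (hτ : 0 ≤ τ) :
    (G τ, symbolOp H (G τ)) ∈ symbolGraph H :=
  mem_symbolGraph_symbolOp (hu.domain τ hτ)

theorem auxField_mem_symbolGraph (hu : IsSolution ρ g H u v G) (ht : 0 ≤ t) (s : ℝ) :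
    (auxField G t s, auxField (fun τ => symbolOp H (G τ)) t s) ∈ symbolGraph H :=
  NonlocalVisco.auxField_mem_symbolGraph hu.continuousOn_gradient hu.continuousOn_psi
    (fun _ => hu.mem_symbolGraph) ht s

theorem auxField_mem_symbolGraph_inv (hu : IsSolution ρ g H u v G)
    (hH : ∀ k, k ≠ 0 → (H k).PosDef) (ht : 0 ≤ t) (s : ℝ) :
    (auxField (fun τ => symbolOp H (G τ)) t s, auxField G t s) ∈
      symbolGraph fun k => (H k)⁻¹ :=
  mem_symbolGraph_inv (fun k hk => (hH k hk).det_pos.ne'.isUnit) (hu.auxField_mem_symbolGraph ht s)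

theorem storedDensity_eq (hu : IsSolution ρ g H u v G) (hH : ∀ k, k ≠ 0 → (H k).PosDef)
    (ht : 0 ≤ t) (s : ℝ) :
    storedDensity H (fun τ => symbolOp H (G τ)) t s = ∫ τ in Ioc 0 t, ∫ a in Ioc 0 t,
      Complex.exp (Complex.I * s * (a - τ)) * energyKernel (fun τ => symbolOp H (G τ)) G a τ := by
  rw [storedDensity_eq_sum_inner (hu.auxField_mem_symbolGraph_inv hH ht s),
    sum_inner_auxField hu.continuousOn_psi hu.continuousOn_gradient ht]

theorem storedDensity_nonneg (hu : IsSolution ρ g H u v G) (hH : ∀ k, k ≠ 0 → (H k).PosDef)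
    (ht : 0 ≤ t) (s : ℝ) : 0 ≤ storedDensity H (fun τ => symbolOp H (G τ)) t s := by
  rw [storedDensity_eq_sum_inner (hu.auxField_mem_symbolGraph_inv hH ht s)]
  exact sum_inner_nonneg_of_mem_symbolGraph (fun k hk => (hH k hk).posSemidef)
    (hu.auxField_mem_symbolGraph ht s)

theorem energyKernel_hermitian (hu : IsSolution ρ g H u v G)
    (hH : ∀ k, k ≠ 0 → (H k).IsHermitian) {a τ : ℝ} (ha : 0 ≤ a) (hτ : 0 ≤ τ) :
    energyKernel (fun τ => symbolOp H (G τ)) G τ a =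
      starRingEnd ℂ (energyKernel (fun τ => symbolOp H (G τ)) G a τ) := by
  simp only [energyKernel, map_sum, inner_conj_symm]
  exact sum_inner_comm_of_mem_symbolGraph hH (hu.mem_symbolGraph hτ) (hu.mem_symbolGraph ha)

theorem integrable_and_integral_storedDensity (hu : IsSolution ρ g H u v G)
    (hg : LocallyIntegrableOn g (Ici 0)) (hm : IsSpectralMeasure g m)
    (hH : ∀ k, k ≠ 0 → (H k).PosDef) (ht : 0 ≤ t) :
    Integrable (storedDensity H (fun τ => symbolOp H (G τ)) t) m ∧
      ∫ s, storedDensity H (fun τ => symbolOp H (G τ)) t s ∂m =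
        (2 * (∫ τ in (0 : ℝ)..t,
          ∑ c, inner ℂ (stress g (fun τ => symbolOp H (G τ)) τ c) (G τ c)).re : ℝ) := by
  have hform := hm.integrable_and_integral_energyForm hg
    (continuousOn_energyKernel (t := t) hu.continuousOn_psi hu.continuousOn_gradient)
    (fun a ha τ hτ =>
      hu.energyKernel_hermitian (fun k hk => (hH k hk).isHermitian) ha.1.le hτ.1.le)
    fun s => hu.storedDensity_eq hH ht s ▸ hu.storedDensity_nonneg hH ht s
  simp only [← hu.storedDensity_eq hH ht] at hform
  rwa [setIntegral_congr_fun measurableSet_Ioc fun τ hτ =>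
    setIntegral_energyKernel hg hu.continuousOn_psi hτ.1.le,
    ← intervalIntegral.integral_of_le ht] at hform

theorem inDomain_inv_auxField (hu : IsSolution ρ g H u v G) (hH : ∀ k, k ≠ 0 → (H k).PosDef)
    (ht : 0 ≤ t) (s : ℝ) :
    InDomain (fun k => (H k)⁻¹) (auxField (fun τ => symbolOp H (G τ)) t s) :=
  inDomain_of_mem_symbolGraph (hu.auxField_mem_symbolGraph_inv hH ht s)

theorem storedEnergy_nonneg (hu : IsSolution ρ g H u v G) (hH : ∀ k, k ≠ 0 → (H k).PosDef)
    (ht : 0 ≤ t) : 0 ≤ storedEnergy m H (fun τ => symbolOp H (G τ)) t :=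
  mul_nonneg (by positivity) (integral_nonneg fun s => hu.storedDensity_nonneg hH ht s)

theorem storedEnergy_eq (hu : IsSolution ρ g H u v G) (hg : LocallyIntegrableOn g (Ici 0))
    (hm : IsSpectralMeasure g m) (hH : ∀ k, k ≠ 0 → (H k).PosDef) (ht : 0 ≤ t) :
    storedEnergy m H (fun τ => symbolOp H (G τ)) t = ((∫ τ in (0 : ℝ)..t,
      ∑ c, inner ℂ (stress g (fun τ => symbolOp H (G τ)) τ c) (G τ c)).re : ℝ) := by
  rw [storedEnergy, (hu.integrable_and_integral_storedDensity hg hm hH ht).2]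
  push_cast
  ring

theorem hasDerivWithinAt_storedEnergy (hu : IsSolution ρ g H u v G)
    (hg : LocallyIntegrableOn g (Ici 0)) (hm : IsSpectralMeasure g m)
    (hH : ∀ k, k ≠ 0 → (H k).PosDef) (ht : 0 ≤ t) :
    HasDerivWithinAt (storedEnergy m H fun τ => symbolOp H (G τ))
      ((∑ c, inner ℂ (stress g (fun τ => symbolOp H (G τ)) t c) (G t c)).re : ℝ) (Ici 0) t := by
  have hpower : ContinuousOn
      (fun τ => ∑ c, inner ℂ (stress g (fun τ => symbolOp H (G τ)) τ c) (G τ c)) (Ici 0) :=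
    continuousOn_finsetSum _ fun c _ => (continuousOn_stress hg hu.continuousOn_psi c).inner
      (continuousOn_pi.1 hu.continuousOn_gradient c)
  exact (Complex.reCLM.hasFDerivAt.comp_hasDerivWithinAt t
    (hasDerivWithinAt_integral_Ici hpower self_mem_Ici ht)).ofReal_comp.congr
    (fun τ hτ => hu.storedEnergy_eq hg hm hH hτ) (hu.storedEnergy_eq hg hm hH ht)

theorem hasDerivWithinAt_energy (hu : IsSolution ρ g H u v G)
    (hg : LocallyIntegrableOn g (Ici 0)) (hm : IsSpectralMeasure g m)
    (hH : ∀ k, k ≠ 0 → (H k).PosDef) (ht : 0 ≤ t) :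
    HasDerivWithinAt (fun τ => (kineticEnergy ρ (v τ) : ℂ) +
      storedEnergy m H (fun τ => symbolOp H (G τ)) τ) 0 (Ici 0) t := by
  refine ((hu.hasDerivWithinAt_kineticEnergy hg ht).ofReal_comp.add
    (hu.hasDerivWithinAt_storedEnergy hg hm hH ht)).congr_deriv ?_
  rw [Complex.ofReal_neg, neg_add_cancel]

end IsSolution

end Energy

end NonlocalVisco

end

theorem mainTheorem7 (n : ℕ) (ρ : ℝ) (hρ : 0 < ρ)
    (g : ℝ → ℝ) (hg : NonlocalVisco.IsCausallyPositiveDefinite g)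
    (m : MeasureTheory.Measure ℝ) (hm : NonlocalVisco.IsSpectralMeasure g m)
    (H : NonlocalVisco.Space →
      Matrix (NonlocalVisco.GradIdx n) (NonlocalVisco.GradIdx n) ℝ)
    (hH_meas : ∀ a b, Measurable fun k => H k a b)
    (hH : ∀ k, k ≠ 0 → (H k).IsSymm ∧ (H k).PosDef)
    (u v : ℝ → Fin n → NonlocalVisco.L2)
    (G ψ : ℝ → NonlocalVisco.GradIdx n → NonlocalVisco.L2)
    (hu : NonlocalVisco.IsSolution ρ g H u v G)
    (hψ : ∀ t, ψ t = NonlocalVisco.symbolOp H (G t)) :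
    (∀ t, 0 ≤ t →
      (∀ s, NonlocalVisco.InDomain (fun k => (H k)⁻¹) (NonlocalVisco.auxField ψ t s)) ∧
      MeasureTheory.Integrable (fun s => NonlocalVisco.storedDensity H ψ t s) m) ∧
    (∀ t, 0 ≤ t →
      HasDerivWithinAt
        (fun τ => (NonlocalVisco.kineticEnergy ρ (v τ) : ℂ) +
          NonlocalVisco.storedEnergy m H ψ τ) 0 (Set.Ici 0) t) ∧
    (∀ t, 0 ≤ t →
      0 ≤ (NonlocalVisco.storedEnergy m H ψ t).re ∧
      (NonlocalVisco.storedEnergy m H ψ t).im = 0) := by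
  open NonlocalVisco in
  obtain rfl : ψ = fun t => symbolOp H (G t) := funext hψ
  have hpos (k : Space) (hk : k ≠ 0) : (H k).PosDef := (hH k hk).2
  refine ⟨fun t ht => ⟨hu.inDomain_inv_auxField hpos ht, ?_⟩,
    fun t ht => hu.hasDerivWithinAt_energy hg.1 hm hpos ht, fun t ht => ?_⟩
  · exact (hu.integrable_and_integral_storedDensity hg.1 hm hpos ht).1
  · have hnonneg := Complex.nonneg_iff.1 (hu.storedEnergy_nonneg (m := m) hpos ht)
    exact ⟨hnonneg.1, hnonneg.2.symm⟩
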